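/- Let $(\Sigma,q)$ be a smooth Riemannian $3$-manifold and $\alpha:\Sigma\to(0,\infty)$ smooth, and consider the static spacetime $\mathcal M=\mathbb R\times\Sigma$ with metric $g=-\alpha^2dt^2+q$, with energy-momentum tensor $T_{ab}$ satisfying the Einstein equations $R_{ab}-\tfrac12Rg_{ab}=8\pi G\,T_{ab}$, $G>0$. Let $S_0\subset\Sigma$ be a closed (compact, smooth) surface which divides $\Sigma$ into an inside and an outside region: $S_0=\{f=0\}$, inside $=\{f<0\}$, outside $=\{f>0\}$ for a smooth $f:\Sigma\to\mathbb R$ with $df\neq0$ on $S_0$. Let $\hat r^a$ be its outward unit normal, $h_{ab}=q_{ab}-\hat r_a\hat r_b$, let $k_{ab}=h_a{}^ch_b{}^dD_c\hat r_d$ be its extrinsic curvature in $(\Sigma,q)$, where $D$ is the Levi-Civita connection of $q$, and let $k=q^{ab}k_{ab}$. Let $S=\mathbb R\times S_0$ be the static timelike hypersurface generated by $S_0$. Assume that * $S$ is a transversely trapping surface (TTS): every light ray (future-directed null geodesic of $g$) emitted from a point of $S$ in a direction tangent to $S$ propagates, initially, on $S$ or toward the inside of $S$; * $S$ is convex: the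 principal curvatures $k_1\ge k_2$ of $S_0$ in $\Sigma$ (the eigenvalues of $k_{ab}$) are nonnegative at each point of $S_0$; * $\rho+P_r=0$ on $S$, where $\rho=T_{ab}n^an^b$ with $n^a=\alpha^{-1}(\partial_t)^a$, and $P_r=T_{ab}\hat r^a\hat r^b$. A radial foliation starting from $S_0$ is given by a smooth function $r$ with $dr\ne0$ on a neighborhood of $S_0$ that has the same zero set and is positive on the same side as $f$; its lapse is $\varphi=1/|Dr|$, and $\hat r^aD_ak$ denotes the derivative on $S_0$, in the direction of the unit normal, of the mean curvature $k$ of the level sets of $r$. The surface $S_0$ is called a loosely trapped surface (LTS) if $k>0$ and $\hat r^aD_ak\ge0$ on $S_0$ for some radial foliation (that is, for some choice of the lapse $\varphi$) starting from $S_0$. Then there is a radial foliation starting from $S_0$ with $k\ge0$ and $\hat r^aD_ak\ge0$ on $S_0$; and if moreover $k_{ab}$ does not vanish at any point of $S_0$ (that is, $k_1$ and $k_2$ are nowhere both zero), then $S_0$ is a loosely trapped surface. -/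

import Mathlib

open scoped Manifold ContDiff Topology Bundle
open Set Filter

noncomputable section

/-! # Pseudo-Riemannian geometry in coordinates

A metric in coordinates is a function `g : E → E →L[ℝ] E →L[ℝ] ℝ` on the coordinate space `E`,
with values in the bilinear forms on `E`. -/

namespace CoordGeom

variable {E : Type*} [NormedAddCommGroup E] [NormedSpace ℝ E]

/-- Trace of a bilinear form with respect to a nondegenerate symmetric form `b`: the sum
`b^{ij} B_{ij} = ∑ i, B(e_i, b⁻¹(e^i))`, which is the same for all bases `e_i`. -/
def metricTrace [FiniteDimensional ℝ E] (b : E →L[ℝ] E →L[ℝ] ℝ) (B : E → E → ℝ) : ℝ :=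
  ∑ i, B (Module.finBasis ℝ E i)
    (b.inverse (LinearMap.toContinuousLinearMap ((Module.finBasis ℝ E).coord i)))

/-- The Christoffel symbols `Γ(u, v)` of the Levi-Civita connection. -/
def christoffel (g : E → E →L[ℝ] E →L[ℝ] ℝ) (x u v : E) : E :=
  (1 / 2 : ℝ) • (g x).inverse
    (fderiv ℝ (fun y => g y v) x u + fderiv ℝ (fun y => g y u) x v
      - fderiv ℝ (fun y => g y u v) x)

/-- The Koszul formula: `2 g(Γ(u, v), w) = ∂_u g(v, w) + ∂_v g(u, w) - ∂_w g(u, v)`. -/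
theorem christoffel_koszul (g : E → E →L[ℝ] E →L[ℝ] ℝ) (x : E) (hg : (g x).IsInvertible)
    (u v w : E) :
    g x (christoffel g x u v) w
      = (1 / 2) * (fderiv ℝ (fun y => g y v) x u w + fderiv ℝ (fun y => g y u) x v w
        - fderiv ℝ (fun y => g y u v) x w) := by
  obtain ⟨L, hL⟩ := hg
  simp [christoffel, ← hL]

/-- The Riemann tensor
`R(u, v) w = ∂_u Γ(v, w) - ∂_v Γ(u, w) + Γ(u, Γ(v, w)) - Γ(v, Γ(u, w))`. -/
def riemann (g : E → E →L[ℝ] E →L[ℝ] ℝ) (x u v w : E) : E :=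
  fderiv ℝ (fun y => christoffel g y v w) x u - fderiv ℝ (fun y => christoffel g y u w) x v
    + christoffel g x u (christoffel g x v w) - christoffel g x v (christoffel g x u w)

/-- The Ricci tensor `Ric(v, w)`, the trace of `u ↦ R(u, v) w`. -/
def ricci [FiniteDimensional ℝ E] (g : E → E →L[ℝ] E →L[ℝ] ℝ) (x v w : E) : ℝ :=
  ∑ i, (Module.finBasis ℝ E).coord i (riemann g x (Module.finBasis ℝ E i) v w)

/-- The scalar curvature. -/
def scalarCurvature [FiniteDimensional ℝ E] (g : E → E →L[ℝ] E →L[ℝ] ℝ) (x : E) : ℝ :=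
  metricTrace (g x) (ricci g x)

/-- The covariant derivative `D_u X` of a vector field `X` at `x`. -/
def covDeriv (g : E → E →L[ℝ] E →L[ℝ] ℝ) (X : E → E) (x u : E) : E :=
  fderiv ℝ X x u + christoffel g x u (X x)

/-- The gradient of a function. -/
def grad (g : E → E →L[ℝ] E →L[ℝ] ℝ) (r : E → ℝ) (x : E) : E :=
  (g x).inverse (fderiv ℝ r x)

/-- The unit normal `r̂ = grad r / |grad r|` of the level sets of `r`. -/
def unitNormal (g : E → E →L[ℝ] E →L[ℝ] ℝ) (r : E → ℝ) (x : E) : E :=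
  (1 / Real.sqrt (g x (grad g r x) (grad g r x))) • grad g r x

/-- The orthogonal projection to the tangent space of the level set of `r` through `x`. -/
def tangentProj (g : E → E →L[ℝ] E →L[ℝ] ℝ) (r : E → ℝ) (x u : E) : E :=
  u - g x (unitNormal g r x) u • unitNormal g r x

/-- The extrinsic curvature `k_{ab} = h_a^c h_b^d D_c r̂_d` of the level set of `r` through `x`. -/
def extrinsicCurvature (g : E → E →L[ℝ] E →L[ℝ] ℝ) (r : E → ℝ) (x u v : E) : ℝ :=
  g x (covDeriv g (unitNormal g r) x (tangentProj g r x u)) (tangentProj g r x v)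

/-- The trace `k` of the extrinsic curvature of the level set of `r` through `x`. -/
def meanCurvature [FiniteDimensional ℝ E] (g : E → E →L[ℝ] E →L[ℝ] ℝ) (r : E → ℝ) (x : E) : ℝ :=
  metricTrace (g x) (extrinsicCurvature g r x)

/-- `κ` is a principal curvature at `x` of the level set of `r` through `x`: an eigenvalue of the
extrinsic curvature, restricted to the tangent space, with respect to the induced metric. -/
def IsPrincipalCurvature (g : E → E →L[ℝ] E →L[ℝ] ℝ) (r : E → ℝ) (x : E) (κ : ℝ) : Prop :=
  ∃ u : E, u ≠ 0 ∧ fderiv ℝ r x u = 0 ∧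
    ∀ v : E, fderiv ℝ r x v = 0 → extrinsicCurvature g r x u v = κ * g x u v

/-- The derivative `r̂^a D_a k` at `x` of the mean curvature of the level sets of `r`. -/
def normalDerivMeanCurvature [FiniteDimensional ℝ E]
    (g : E → E →L[ℝ] E →L[ℝ] ℝ) (r : E → ℝ) (x : E) : ℝ :=
  fderiv ℝ (meanCurvature g r) x (unitNormal g r x)

end CoordGeom

/-! # Tensors, geodesics and the Einstein equations on manifolds -/

section Manifolds

variable {E : Type*} [NormedAddCommGroup E] [NormedSpace ℝ E]
  {H : Type*} [TopologicalSpace H] (I : ModelWithCorners ℝ E H)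
  {M : Type*} [TopologicalSpace M] [ChartedSpace H M]

/-- The expression of a field of bilinear forms in the coordinates given by a chart `e`. -/
def localForm (g : ∀ x : M, TangentSpace I x →L[ℝ] TangentSpace I x →L[ℝ] ℝ)
    (e : OpenPartialHomeomorph M H) (y : E) : E →L[ℝ] E →L[ℝ] ℝ :=
  let A : E →L[ℝ] E := mfderiv 𝓘(ℝ, E) I (e.extend I).symm y
  let B : E →L[ℝ] E →L[ℝ] ℝ := g ((e.extend I).symm y)
  B.bilinearComp A A

/-- `γ` is an affinely parametrized geodesic of the metric `g` on the set `J` of parameters: it is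
continuous, and around each parameter it is, in the coordinates of some chart, a solution of
`c'' + Γ(c', c') = 0`. (This does not depend on the chart.) -/
def IsGeodesicOn (g : ∀ x : M, TangentSpace I x →L[ℝ] TangentSpace I x →L[ℝ] ℝ)
    (γ : ℝ → M) (J : Set ℝ) : Prop :=
  ContinuousOn γ J ∧ ∀ s ∈ J, ∃ e ∈ IsManifold.maximalAtlas I ∞ M, γ s ∈ e.source ∧
    (∀ᶠ s' in 𝓝 s, DifferentiableAt ℝ (e.extend I ∘ γ) s') ∧
    HasDerivAt (deriv (e.extend I ∘ γ))
      (-CoordGeom.christoffel (localForm I g e) (e.extend I (γ s))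
        (deriv (e.extend I ∘ γ) s) (deriv (e.extend I ∘ γ) s)) s

/-- The Einstein equations `R_{ab} - (1/2) R g_{ab} = 8 π G T_{ab}`, in every chart. -/
def EinsteinEquations [FiniteDimensional ℝ E] (G : ℝ)
    (g T : ∀ x : M, TangentSpace I x →L[ℝ] TangentSpace I x →L[ℝ] ℝ) : Prop :=
  ∀ e ∈ IsManifold.maximalAtlas I ∞ M, ∀ x ∈ e.source, ∀ u v : E,
    CoordGeom.ricci (localForm I g e) (e.extend I x) u v
      - (1 / 2) * CoordGeom.scalarCurvature (localForm I g e) (e.extend I x)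
        * localForm I g e (e.extend I x) u v
      = 8 * Real.pi * G * localForm I T e (e.extend I x) u v

end Manifolds

/-! # Static spacetimes and surfaces in their static slices -/

/-- The model space of three-dimensional manifolds. -/
abbrev E3 : Type := EuclideanSpace ℝ (Fin 3)

/-- The model with corners of the spacetime `ℝ × X`. -/
abbrev I4 : ModelWithCorners ℝ (ℝ × E3) (ModelProd ℝ E3) := 𝓘(ℝ, ℝ).prod 𝓘(ℝ, E3)

section Static

variable (X : Type*) [TopologicalSpace X] [ChartedSpace E3 X] [IsManifold 𝓘(ℝ, E3) ∞ X]

/-- The data of a static spacetime `ℝ × X` with static slice `X`: the Riemannian metric `q` and the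
lapse function `α > 0` of the slice. -/
structure StaticSpacetime where
  q : Bundle.ContMDiffRiemannianMetric 𝓘(ℝ, E3) ∞ E3 (fun x : X => TangentSpace 𝓘(ℝ, E3) x)
  α : X → ℝ
  smooth_α : ContMDiff 𝓘(ℝ, E3) 𝓘(ℝ, ℝ) ∞ α
  α_pos : ∀ x, 0 < α x

/-- A closed surface `{f = 0}` dividing the slice `X` into the inside region `{f < 0}` and the
outside region `{0 < f}`; `f` is a smooth function without critical points on the surface. -/
structure DividingSurface where
  f : X → ℝ
  smooth_f : ContMDiff 𝓘(ℝ, E3) 𝓘(ℝ, ℝ) ∞ f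
  isCompact : IsCompact {x | f x = 0}
  regular : ∀ x, f x = 0 → mfderiv 𝓘(ℝ, E3) 𝓘(ℝ, ℝ) f x ≠ 0

variable {X}

/-- The surface `S₀`. -/
def DividingSurface.carrier (S : DividingSurface X) : Set X := {x | S.f x = 0}

/-- The spacetime metric `-α² dt² + q` on `ℝ × X`. -/
def StaticSpacetime.metric (W : StaticSpacetime X) (x : ℝ × X) :
    TangentSpace I4 x →L[ℝ] TangentSpace I4 x →L[ℝ] ℝ :=
  let q : E3 →L[ℝ] E3 →L[ℝ] ℝ := W.q.inner x.2
  let dt : ℝ × E3 →L[ℝ] ℝ := ContinuousLinearMap.fst ℝ ℝ E3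
  let pr : ℝ × E3 →L[ℝ] E3 := ContinuousLinearMap.snd ℝ ℝ E3
  let g : ℝ × E3 →L[ℝ] ℝ × E3 →L[ℝ] ℝ :=
    q.bilinearComp pr pr - (W.α x.2 ^ 2) • dt.smulRight dt
  g

/-- A vector of the spacetime `ℝ × X` from its time and space components. -/
def spacetimeVector (x : ℝ × X) (τ : ℝ) (v : TangentSpace 𝓘(ℝ, E3) x.2) : TangentSpace I4 x :=
  ((τ, v) : ℝ × E3)

/-- `v` is the outward unit normal `r̂` of the surface at its point `p`. -/
def IsOutwardUnitNormal (W : StaticSpacetime X) (S : DividingSurface X) (p : X)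
    (v : TangentSpace 𝓘(ℝ, E3) p) : Prop :=
  W.q.inner p v v = 1 ∧
  (∀ u : TangentSpace 𝓘(ℝ, E3) p, mfderiv 𝓘(ℝ, E3) 𝓘(ℝ, ℝ) S.f p u = (0 : ℝ) →
    W.q.inner p v u = 0) ∧
  (0 : ℝ) < mfderiv 𝓘(ℝ, E3) 𝓘(ℝ, ℝ) S.f p v

/-- `ρ + P_r = 0` on the static hypersurface `ℝ × S₀`, where `ρ = T(n, n)` with
`n = α⁻¹ ∂_t` and `P_r = T(r̂, r̂)`. -/
def EnergyPlusRadialPressureVanishes (W : StaticSpacetime X) (S : DividingSurface X)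
    (T : ∀ x : ℝ × X, TangentSpace I4 x →L[ℝ] TangentSpace I4 x →L[ℝ] ℝ) : Prop :=
  ∀ x : ℝ × X, x.2 ∈ S.carrier → ∀ v : TangentSpace 𝓘(ℝ, E3) x.2,
    IsOutwardUnitNormal W S x.2 v →
    T x (spacetimeVector x (W.α x.2)⁻¹ 0) (spacetimeVector x (W.α x.2)⁻¹ 0)
      + T x (spacetimeVector x 0 v) (spacetimeVector x 0 v) = 0

/-- The static timelike hypersurface `ℝ × S₀` is a transversely trapping surface: every light ray
(future-directed null geodesic) emitted from one of its points in a tangential direction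
propagates on the hypersurface or toward its inside. -/
def IsTTS (W : StaticSpacetime X) (S : DividingSurface X) : Prop :=
  ∀ (ε : ℝ) (γ : ℝ → ℝ × X) (τ : ℝ) (v : TangentSpace 𝓘(ℝ, E3) (γ 0).2),
    0 < ε → IsGeodesicOn I4 W.metric γ (Ioo (-ε) ε) →
    HasMFDerivAt 𝓘(ℝ, ℝ) I4 γ 0
      ((ContinuousLinearMap.id ℝ ℝ).smulRight (spacetimeVector (γ 0) τ v)) →
    0 < τ →
    W.metric (γ 0) (spacetimeVector (γ 0) τ v) (spacetimeVector (γ 0) τ v) = 0 →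
    (γ 0).2 ∈ S.carrier →
    mfderiv 𝓘(ℝ, E3) 𝓘(ℝ, ℝ) S.f (γ 0).2 v = (0 : ℝ) →
    ∀ᶠ s in 𝓝[>] (0 : ℝ), S.f (γ s).2 ≤ 0

/-- The metric of the static slice in the coordinates of a chart. -/
def StaticSpacetime.localMetric (W : StaticSpacetime X) (e : OpenPartialHomeomorph X E3) :
    E3 → E3 →L[ℝ] E3 →L[ℝ] ℝ :=
  localForm 𝓘(ℝ, E3) W.q.inner e

/-- A function on the static slice in the coordinates of a chart. -/
def localFun (r : X → ℝ) (e : OpenPartialHomeomorph X E3) : E3 → ℝ :=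
  r ∘ (e.extend 𝓘(ℝ, E3)).symm

/-- The surface is convex: its principal curvatures `k₁`, `k₂` are nonnegative. -/
def IsConvexSurface (W : StaticSpacetime X) (S : DividingSurface X) : Prop :=
  ∀ e ∈ IsManifold.maximalAtlas 𝓘(ℝ, E3) ∞ X, ∀ p ∈ e.source, p ∈ S.carrier → ∀ κ : ℝ,
    CoordGeom.IsPrincipalCurvature (W.localMetric e) (localFun S.f e)
      (e.extend 𝓘(ℝ, E3) p) κ → 0 ≤ κ

/-- The extrinsic curvature `k_{ab}` of the surface in the slice is nonzero at each point. -/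
def ExtrinsicCurvatureNowhereZero (W : StaticSpacetime X) (S : DividingSurface X) : Prop :=
  ∀ e ∈ IsManifold.maximalAtlas 𝓘(ℝ, E3) ∞ X, ∀ p ∈ e.source, p ∈ S.carrier →
    ∃ u v : E3, CoordGeom.extrinsicCurvature (W.localMetric e) (localFun S.f e)
      (e.extend 𝓘(ℝ, E3) p) u v ≠ 0

/-- A radial foliation starting from `S₀`: a smooth function `r` near `S₀` without critical points,
with `S₀ = {r = 0}` and increasing to the outside. Its lapse is `φ = 1 / |D r|`. -/
def IsRadialFoliation (S : DividingSurface X) (r : X → ℝ) : Prop :=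
  ∃ U : Set X, IsOpen U ∧ S.carrier ⊆ U ∧ ContMDiffOn 𝓘(ℝ, E3) 𝓘(ℝ, ℝ) ∞ r U ∧
    ∀ x ∈ U, mfderiv 𝓘(ℝ, E3) 𝓘(ℝ, ℝ) r x ≠ 0 ∧
      (r x = 0 ↔ S.f x = 0) ∧ (0 < r x ↔ 0 < S.f x)

/-- The surface is a loosely trapped surface: `k > 0` and `r̂^a D_a k ≥ 0` on `S₀`, for some radial
foliation (that is, for some choice of the lapse `φ`) starting from `S₀`. -/
def IsLTS (W : StaticSpacetime X) (S : DividingSurface X) : Prop :=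
  ∃ r : X → ℝ, IsRadialFoliation S r ∧
    ∀ e ∈ IsManifold.maximalAtlas 𝓘(ℝ, E3) ∞ X, ∀ p ∈ e.source, p ∈ S.carrier →
      0 < CoordGeom.meanCurvature (W.localMetric e) (localFun r e) (e.extend 𝓘(ℝ, E3) p) ∧
      0 ≤ CoordGeom.normalDerivMeanCurvature (W.localMetric e) (localFun r e)
        (e.extend 𝓘(ℝ, E3) p)

/-- The condition of a loosely trapped surface with `k ≥ 0` in place of `k > 0`. -/
def IsWeakLTS (W : StaticSpacetime X) (S : DividingSurface X) : Prop :=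
  ∃ r : X → ℝ, IsRadialFoliation S r ∧
    ∀ e ∈ IsManifold.maximalAtlas 𝓘(ℝ, E3) ∞ X, ∀ p ∈ e.source, p ∈ S.carrier →
      0 ≤ CoordGeom.meanCurvature (W.localMetric e) (localFun r e) (e.extend 𝓘(ℝ, E3) p) ∧
      0 ≤ CoordGeom.normalDerivMeanCurvature (W.localMetric e) (localFun r e)
        (e.extend 𝓘(ℝ, E3) p)

end Static

end

/-! The foliation is chosen so that its lapse equals `α` on the surface. Take `r = f ρ` with `ρ = 1
/ (α |D f|)`; then `|D r| = 1 / α` where `f = 0`. The claim reduces to a sign of `N(k)`, where `N`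
is the unit normal, `A = DN` and `K` is the Weingarten map.

The Bochner identity (`fderiv_div`) gives `N(k) = div(D_N N) - tr(A²) - Ric(N, N)`, and `tr(A²) =
tr(K²)`. Since the lapse is `α` on the surface, `D_N N` is there minus the tangential gradient of
`log α`, and `div(D_N N) = (Hess α(N, N) + N(α) k - Δα) / α` (`trace_covDerivCLM_acceleration`).

Adding the Einstein equations on `n` and on `N` cancels the scalar curvature, because `g(n, n) +
g(N, N) = 0`. With `ρ + P_r = 0` and the Ricci tensor of a static metric, this yields `α Ric(N, N) =
Hess α(N, N) - Δα` (`ricci_unitNormal`). The second derivatives of `α` therefore cancel: with `lam =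
N(α) / α` and `κ_i` the eigenvalues of `K`, `N(k) = lam tr K - tr(K²) = ∑ κ_i (lam - κ_i)`.

The trapping condition supplies `κ_i ≤ lam`: along a null geodesic with initial velocity `(τ, u)`,
`u` tangent to the surface, the second derivative of `f` is `Hess f(u, u) - τ² α df(grad α)`, where
`α² τ² = |u|²`. It cannot be positive, or the ray would move outward (`hess_le_of_isTTS`). Convexity
supplies `0 ≤ κ_i`. Every summand is then nonnegative, and so is `k = ∑ κ_i`, which is zero only if
`K = 0`.

Everything is computed in charts. The function `r` is defined without charts, so that a single
foliation serves all of them. -/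

noncomputable section

set_option maxSynthPendingDepth 3
set_option linter.unusedSectionVars false

namespace CoordGeom

/-! ### Traces, eigenbases and invertibility of bilinear forms. -/

section LinearAlgebra

variable {E : Type*} [NormedAddCommGroup E] [NormedSpace ℝ E] [FiniteDimensional ℝ E]

/-- The trace of an endomorphism, as a continuous linear functional. -/
def traceCLM (E : Type*) [NormedAddCommGroup E] [NormedSpace ℝ E] [FiniteDimensional ℝ E] :
    (E →L[ℝ] E) →L[ℝ] ℝ :=
  LinearMap.toContinuousLinearMap (LinearMap.trace ℝ E ∘ₗ ContinuousLinearMap.coeLM ℝ)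

lemma traceCLM_apply (L : E →L[ℝ] E) : traceCLM E L = LinearMap.trace ℝ E L := rfl

lemma sum_coord_eq_trace {ι V : Type*} [AddCommGroup V] [Module ℝ V] [Fintype ι]
    (b : Module.Basis ι ℝ V) (L : V →ₗ[ℝ] V) :
    ∑ i, b.coord i (L (b i)) = LinearMap.trace ℝ V L := by
  classical
  rw [LinearMap.trace_eq_matrix_trace ℝ b, Matrix.trace]
  simp [LinearMap.toMatrix_apply]

lemma traceCLM_comp_comm (L L' : E →L[ℝ] E) : traceCLM E (L ∘L L') = traceCLM E (L' ∘L L) := by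
  simp only [traceCLM_apply]
  exact LinearMap.trace_mul_comm ℝ (L : E →ₗ[ℝ] E) (L' : E →ₗ[ℝ] E)

lemma traceCLM_smulRight (φ : E →L[ℝ] ℝ) (z : E) : traceCLM E (φ.smulRight z) = φ z := by
  rw [traceCLM_apply, ← sum_coord_eq_trace (Module.finBasis ℝ E)]
  have h : z = ∑ i, (Module.finBasis ℝ E).repr z i • Module.finBasis ℝ E i :=
    ((Module.finBasis ℝ E).sum_repr z).symm
  conv_rhs => rw [h]
  rw [map_sum]
  simp [mul_comm]

/-- By symmetry, pairing `A e_i` with the raised covector `b⁻¹(e^i)` returns the coordinate `e^i(A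
e_i)`. This turns the mean curvature into the trace of an endomorphism. -/
lemma metricTrace_eq_traceCLM (b : E →L[ℝ] E →L[ℝ] ℝ) (hb : b.IsInvertible)
    (hs : ∀ u v, b u v = b v u) (A : E →L[ℝ] E) :
    metricTrace b (fun u v => b (A u) v) = traceCLM E A := by
  rw [traceCLM_apply, ← sum_coord_eq_trace (Module.finBasis ℝ E), metricTrace]
  refine Finset.sum_congr rfl fun i _ => ?_
  rw [hs, hb.self_apply_inverse]
  rfl

/-- A linear map which is symmetric with respect to an inner product has an eigenbasis. -/
lemma exists_eigenbasis {V : Type*} [AddCommGroup V] [Module ℝ V] [FiniteDimensional ℝ V]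
    (b : V →ₗ[ℝ] V →ₗ[ℝ] ℝ) (hs : ∀ u v, b u v = b v u) (hpos : ∀ u, u ≠ 0 → 0 < b u u)
    (L : V →ₗ[ℝ] V) (hL : ∀ u v, b (L u) v = b u (L v)) :
    ∃ (e : Module.Basis (Fin (Module.finrank ℝ V)) ℝ V) (κ : Fin (Module.finrank ℝ V) → ℝ),
      ∀ i, L (e i) = κ i • e i := by
  -- With `b` itself as inner product, the hypothesis on `L` is self-adjointness, and the spectral
  -- theorem applies.
  let core : InnerProductSpace.Core ℝ V :=
    { inner := fun u v => b u v
      conj_inner_symm := fun u v => by simp [hs u v]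
      re_inner_nonneg := fun u => by
        by_cases h : u = 0
        · simp [h]
        · simpa using (hpos u h).le
      add_left := fun u v w => by simp
      smul_left := fun u v c => by simp
      definite := fun u h => by
        by_contra hu
        exact (hpos u hu).ne' h }
  let _ : NormedAddCommGroup V := core.toNormedAddCommGroup
  let _ : InnerProductSpace ℝ V := InnerProductSpace.ofCore core.toCore
  have hsym : L.IsSymmetric := fun u v => hL u v
  refine ⟨(hsym.eigenvectorBasis rfl).toBasis, hsym.eigenvalues rfl, fun i => ?_⟩
  simp [hsym.apply_eigenvectorBasis rfl i]

lemma trace_eq_sum_of_eigenbasis {ι V : Type*} [AddCommGroup V] [Module ℝ V] [Fintype ι]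
    (e : Module.Basis ι ℝ V) (L : V →ₗ[ℝ] V) (κ : ι → ℝ) (h : ∀ i, L (e i) = κ i • e i) :
    LinearMap.trace ℝ V L = ∑ i, κ i := by
  rw [← sum_coord_eq_trace e]
  simp [h]

lemma isInvertible_of_injective (b : E →L[ℝ] E →L[ℝ] ℝ) (h : ∀ u, (∀ v, b u v = 0) → u = 0) :
    b.IsInvertible := by
  have hinj : Function.Injective b := by
    rw [injective_iff_map_eq_zero]
    exact fun u hu => h u fun v => by simp [hu]
  have hfr : Module.finrank ℝ E = Module.finrank ℝ (E →L[ℝ] ℝ) := by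
    rw [LinearEquiv.finrank_eq (LinearMap.toContinuousLinearMap : (E →ₗ[ℝ] ℝ) ≃ₗ[ℝ] _).symm]
    exact (Subspace.dual_finrank_eq).symm
  refine ⟨(LinearEquiv.ofInjectiveOfFinrankEq (b : E →ₗ[ℝ] (E →L[ℝ] ℝ)) hinj
    hfr).toContinuousLinearEquiv, ?_⟩
  ext u v
  rfl

lemma isInvertible_of_pos (b : E →L[ℝ] E →L[ℝ] ℝ) (hpos : ∀ u, u ≠ 0 → 0 < b u u) :
    b.IsInvertible :=
  isInvertible_of_injective b fun u hu => by
    by_contra hne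
    exact (hpos u hne).ne' (hu u)

end LinearAlgebra

/-! ### The Levi-Civita connection and the Bochner identity. -/

section Connection

variable {E : Type*} [NormedAddCommGroup E] [NormedSpace ℝ E] [FiniteDimensional ℝ E]

/-- `g` is a smooth nondegenerate metric on the open set `Ω`. -/
structure IsMetricOn (g : E → E →L[ℝ] E →L[ℝ] ℝ) (Ω : Set E) : Prop where
  isOpen : IsOpen Ω
  smooth : ContDiffOn ℝ ∞ g Ω
  symm : ∀ x ∈ Ω, ∀ u v, g x u v = g x v u
  inv : ∀ x ∈ Ω, (g x).IsInvertible

/-- `T ↦ ((u, v, w) ↦ T(u, v, w) + T(v, u, w) - T(w, u, v))` -/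
def koszulCLM (E : Type*) [NormedAddCommGroup E] [NormedSpace ℝ E] :
    (E →L[ℝ] E →L[ℝ] E →L[ℝ] ℝ) →L[ℝ] (E →L[ℝ] E →L[ℝ] E →L[ℝ] ℝ) :=
  let F : (E →L[ℝ] E →L[ℝ] E →L[ℝ] ℝ) →L[ℝ] (E →L[ℝ] E →L[ℝ] E →L[ℝ] ℝ) :=
    (ContinuousLinearMap.flipₗᵢ ℝ E E (E →L[ℝ] ℝ)).toContinuousLinearEquiv
  let F' : (E →L[ℝ] E →L[ℝ] ℝ) →L[ℝ] (E →L[ℝ] E →L[ℝ] ℝ) :=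
    (ContinuousLinearMap.flipₗᵢ ℝ E E ℝ).toContinuousLinearEquiv
  ContinuousLinearMap.id ℝ _ + F - (ContinuousLinearMap.compL ℝ E _ _ F') ∘L F

lemma koszulCLM_apply (T : E →L[ℝ] E →L[ℝ] E →L[ℝ] ℝ) (u v w : E) :
    koszulCLM E T u v w = T u v w + T v u w - T w u v := by
  simp only [koszulCLM, sub_apply, add_apply, ContinuousLinearMap.comp_apply,
    ContinuousLinearMap.compL_apply, ContinuousLinearMap.id_apply]
  rfl

/-- The Christoffel symbols as a field of continuous bilinear maps. -/
def christoffelCLM (g : E → E →L[ℝ] E →L[ℝ] ℝ) (x : E) : E →L[ℝ] E →L[ℝ] E :=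
  (1 / 2 : ℝ) • (ContinuousLinearMap.compL ℝ E (E →L[ℝ] ℝ) E (g x).inverse) ∘L
    koszulCLM E (fderiv ℝ g x)

variable {g : E → E →L[ℝ] E →L[ℝ] ℝ} {Ω : Set E}

lemma IsMetricOn.contDiffAt (hg : IsMetricOn g Ω) {x : E} (hx : x ∈ Ω) : ContDiffAt ℝ ∞ g x :=
  hg.smooth.contDiffAt (hg.isOpen.mem_nhds hx)

lemma IsMetricOn.differentiableAt (hg : IsMetricOn g Ω) {x : E} (hx : x ∈ Ω) :
    DifferentiableAt ℝ g x :=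
  (hg.contDiffAt hx).differentiableAt (by simp)

lemma IsMetricOn.mono (hg : IsMetricOn g Ω) {Ω' : Set E} (ho : IsOpen Ω') (h : Ω' ⊆ Ω) :
    IsMetricOn g Ω' :=
  ⟨ho, hg.smooth.mono h, fun x hx => hg.symm x (h hx), fun x hx => hg.inv x (h hx)⟩

/-- The bundled symbols can be differentiated and traced as a single smooth map. Agreement needs `g`
differentiable at `x`, to commute evaluation at fixed vectors with the derivative. -/
lemma christoffelCLM_apply (hg : IsMetricOn g Ω) {x : E} (hx : x ∈ Ω) (u v : E) :
    christoffelCLM g x u v = christoffel g x u v := by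
  have hd := hg.differentiableAt hx
  have h1 : ∀ w, fderiv ℝ (fun y => g y w) x = (fderiv ℝ g x).flip w := fun w => by
    ext z
    rw [fderiv_clm_apply hd (by fun_prop)]
    simp
  have h2 : fderiv ℝ (fun y => g y u v) x = ((fderiv ℝ g x).flip u).flip v := by
    ext z
    rw [fderiv_clm_apply (hd.clm_apply (by fun_prop)) (by fun_prop), h1]
    simp
  simp only [christoffelCLM, christoffel, h1, h2, FunLike.coe_smul, Pi.smul_apply,
    ContinuousLinearMap.coe_comp, Function.comp_apply, ContinuousLinearMap.compL_apply]
  congr 2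

lemma contDiffOn_inverse (hg : IsMetricOn g Ω) :
    ContDiffOn ℝ ∞ (fun x => (g x).inverse) Ω := fun x hx =>
  (ContDiffAt.comp (g := ContinuousLinearMap.inverse) x (hg.inv x hx).contDiffAt_map_inverse
    (hg.contDiffAt hx)).contDiffWithinAt

lemma contDiffOn_christoffelCLM (hg : IsMetricOn g Ω) :
    ContDiffOn ℝ ∞ (christoffelCLM g) Ω := by
  have h1 : ContDiffOn ℝ ∞ (fderiv ℝ g) Ω := hg.smooth.fderiv_of_isOpen hg.isOpen (by simp)
  have h2 := contDiffOn_inverse hg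
  unfold christoffelCLM
  refine ContDiffOn.const_smul _ (ContDiffOn.clm_comp ?_ ?_)
  · exact (ContinuousLinearMap.contDiff _).comp_contDiffOn h2
  · exact (ContinuousLinearMap.contDiff _).comp_contDiffOn h1

lemma christoffel_koszul' (hg : IsMetricOn g Ω) {x : E} (hx : x ∈ Ω) (u v w : E) :
    g x (christoffelCLM g x u v) w
      = (1 / 2) * (fderiv ℝ g x u v w + fderiv ℝ g x v u w - fderiv ℝ g x w u v) := by
  simp only [christoffelCLM, FunLike.coe_smul, Pi.smul_apply,
    ContinuousLinearMap.coe_comp, Function.comp_apply, ContinuousLinearMap.compL_apply, map_smul,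
    (hg.inv x hx).self_apply_inverse, koszulCLM_apply, smul_eq_mul]

lemma fderiv_metric_symm (hg : IsMetricOn g Ω) {x : E} (hx : x ∈ Ω) (u v w : E) :
    fderiv ℝ g x u v w = fderiv ℝ g x u w v := by
  have hd := hg.differentiableAt hx
  have h2 : ∀ v w, fderiv ℝ g x u v w = fderiv ℝ (fun y => g y v w) x u := fun v w => by
    rw [fderiv_clm_apply (hd.clm_apply (by fun_prop)) (by fun_prop),
      fderiv_clm_apply hd (by fun_prop)]
    simp
  rw [h2, h2]
  have : (fun y => g y v w) =ᶠ[𝓝 x] fun y => g y w v := by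
    filter_upwards [hg.isOpen.mem_nhds hx] with y hy using hg.symm y hy v w
  rw [this.fderiv_eq]

/-- The Koszul expression is symmetric in its first two arguments once the derivative of `g` is
known to be a symmetric form, and `g` is nondegenerate. -/
lemma christoffelCLM_symm (hg : IsMetricOn g Ω) {x : E} (hx : x ∈ Ω) (u v : E) :
    christoffelCLM g x u v = christoffelCLM g x v u := by
  apply (hg.inv x hx).injective
  ext w
  rw [christoffel_koszul' hg hx, christoffel_koszul' hg hx, fderiv_metric_symm hg hx w u v]
  ring

/-- The covariant derivative of a vector field, as a field of endomorphisms. -/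
def covDerivCLM (g : E → E →L[ℝ] E →L[ℝ] ℝ) (X : E → E) (x : E) : E →L[ℝ] E :=
  fderiv ℝ X x + (christoffelCLM g x).flip (X x)

lemma covDerivCLM_apply (X : E → E) (x u : E) :
    covDerivCLM g X x u = fderiv ℝ X x u + christoffelCLM g x u (X x) := rfl

lemma covDerivCLM_eq (hg : IsMetricOn g Ω) {x : E} (hx : x ∈ Ω) (X : E → E) (u : E) :
    covDerivCLM g X x u = covDeriv g X x u := by
  rw [covDerivCLM_apply, covDeriv, christoffelCLM_apply hg hx]

lemma contDiffOn_covDerivCLM (hg : IsMetricOn g Ω) {X : E → E} (hX : ContDiffOn ℝ ∞ X Ω) :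
    ContDiffOn ℝ ∞ (covDerivCLM g X) Ω := by
  unfold covDerivCLM
  refine (hX.fderiv_of_isOpen hg.isOpen (by simp)).add (ContDiffOn.clm_apply ?_ hX)
  exact (ContinuousLinearMap.flipₗᵢ ℝ E E E).toContinuousLinearEquiv.contDiff.comp_contDiffOn
    (contDiffOn_christoffelCLM hg)

/-- Metric compatibility, with one of the fields constant. -/
lemma metric_covDerivCLM (hg : IsMetricOn g Ω) {x : E} (hx : x ∈ Ω) {X : E → E}
    (hX : DifferentiableAt ℝ X x) (u v : E) :
    g x (covDerivCLM g X x u) v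
      = fderiv ℝ (fun y => g y (X y)) x u v - g x (X x) (christoffelCLM g x u v) := by
  rw [fderiv_clm_apply (hg.differentiableAt hx) hX, covDerivCLM_apply,
    hg.symm x hx (X x), christoffel_koszul' hg hx, map_add, add_apply,
    christoffel_koszul' hg hx, fderiv_metric_symm hg hx v u (X x),
    fderiv_metric_symm hg hx u (X x) v, fderiv_metric_symm hg hx (X x) u v]
  simp [fderiv_metric_symm hg hx u (X x) v]
  ring

/-- `riemann` is a bare function of `u`; exhibiting it as a linear map `L` makes its coordinate sum
a basis-free trace. -/
lemma ricci_eq_trace {x : E} (v w : E) (L : E →L[ℝ] E)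
    (hL : ∀ u, riemann g x u v w = L u) : ricci g x v w = traceCLM E L := by
  rw [traceCLM_apply, ← sum_coord_eq_trace (Module.finBasis ℝ E), ricci]
  simp [hL]

lemma riemann_eq (hg : IsMetricOn g Ω) {x : E} (hx : x ∈ Ω) (u v w : E) :
    riemann g x u v w = fderiv ℝ (christoffelCLM g) x u v w - fderiv ℝ (christoffelCLM g) x v u w
      + christoffelCLM g x u (christoffelCLM g x v w)
      - christoffelCLM g x v (christoffelCLM g x u w) := by
  have hC : DifferentiableAt ℝ (christoffelCLM g) x :=
    ((contDiffOn_christoffelCLM hg).contDiffAt (hg.isOpen.mem_nhds hx)).differentiableAt (by simp)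
  have h : ∀ a b, fderiv ℝ (fun y => christoffel g y a b) x
      = fderiv ℝ (fun y => christoffelCLM g y a b) x := fun a b => by
    apply Filter.EventuallyEq.fderiv_eq
    filter_upwards [hg.isOpen.mem_nhds hx] with y hy
    rw [christoffelCLM_apply hg hy]
  have h' : ∀ a b c, fderiv ℝ (fun y => christoffelCLM g y a b) x c
      = fderiv ℝ (christoffelCLM g) x c a b := fun a b c => by
    rw [fderiv_clm_apply (hC.clm_apply (by fun_prop)) (by fun_prop),
      fderiv_clm_apply hC (by fun_prop)]
    simp
  simp only [riemann, h, h', christoffelCLM_apply hg hx]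

/-- The Bochner identity `X(div X) = div(D_X X) - tr(DX ∘ DX) - Ric(X, X)`. -/
theorem fderiv_div (hg : IsMetricOn g Ω) {x : E} (hx : x ∈ Ω) {X : E → E}
    (hX : ContDiffOn ℝ ∞ X Ω) :
    fderiv ℝ (fun y => traceCLM E (covDerivCLM g X y)) x (X x)
      = traceCLM E (covDerivCLM g (fun y => covDerivCLM g X y (X y)) x)
        - traceCLM E (covDerivCLM g X x ∘L covDerivCLM g X x) - ricci g x (X x) (X x) := by
  have hΩ := hg.isOpen.mem_nhds hx
  have hC : DifferentiableAt ℝ (christoffelCLM g) x :=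
    ((contDiffOn_christoffelCLM hg).contDiffAt hΩ).differentiableAt (by simp)
  have hXd : DifferentiableAt ℝ X x := (hX.contDiffAt hΩ).differentiableAt (by simp)
  have hX2 : DifferentiableAt ℝ (fderiv ℝ X) x :=
    ((hX.fderiv_of_isOpen (m := ∞) hg.isOpen (by simp)).contDiffAt hΩ).differentiableAt (by simp)
  have hA : DifferentiableAt ℝ (covDerivCLM g X) x :=
    ((contDiffOn_covDerivCLM hg hX).contDiffAt hΩ).differentiableAt (by simp)
  set N := X x with hN
  set C := christoffelCLM g x with hCdef
  set A := covDerivCLM g X x with hAdef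
  have hdA : ∀ u v, fderiv ℝ (covDerivCLM g X) x u v
      = fderiv ℝ (fderiv ℝ X) x u v + fderiv ℝ (christoffelCLM g) x u v N
        + C v (fderiv ℝ X x u) := fun u v => by
    have h1 : fderiv ℝ (covDerivCLM g X) x u v = fderiv ℝ (fun y => covDerivCLM g X y v) x u := by
      rw [fderiv_clm_apply hA (by fun_prop)]; simp
    have h2 : (fun y => covDerivCLM g X y v)
        = fun y => fderiv ℝ X y v + christoffelCLM g y v (X y) := rfl
    have hCv : DifferentiableAt ℝ (fun y => christoffelCLM g y v) x :=
      hC.clm_apply (by fun_prop)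
    rw [h1, h2, fderiv_fun_add (hX2.clm_apply (by fun_prop)) (hCv.clm_apply hXd),
      fderiv_clm_apply hX2 (by fun_prop), fderiv_clm_apply hCv hXd,
      fderiv_clm_apply hC (by fun_prop)]
    simp only [fderiv_fun_const, add_apply, ContinuousLinearMap.comp_apply,
      ContinuousLinearMap.flip_apply, Pi.zero_apply, ContinuousLinearMap.comp_zero, zero_add, hN,
      hCdef]
    abel
  have hsym : ∀ u v, fderiv ℝ (fderiv ℝ X) x u v = fderiv ℝ (fderiv ℝ X) x v u := by
    have : ContDiffAt ℝ ∞ X x := hX.contDiffAt hΩ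
    exact fun u v => (this.isSymmSndFDerivAt (by simp; norm_cast)).eq u v
  let D := fderiv ℝ X x
  -- This is `u ↦ D_u(D_X X) - A(A u) - (D_X A) u`. The covariant derivative `D_X A` is written as
  -- the coordinate derivative plus the commutator of `C N` with `A`; since `A = D + C(·, N)` and
  -- `C` is symmetric, only the commutator with `D` remains. Commutators are traceless, which leaves
  -- `X(div X)`.
  let R : E →L[ℝ] E := covDerivCLM g (fun y => covDerivCLM g X y (X y)) x - A ∘L A
    - fderiv ℝ (covDerivCLM g X) x N - (C N ∘L D - D ∘L C N)
  have hR : ∀ u, riemann g x u N N = R u := fun u => by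
    rw [riemann_eq hg hx, ← hCdef]
    have h3 : covDerivCLM g (fun y => covDerivCLM g X y (X y)) x u
        = fderiv ℝ (covDerivCLM g X) x u N + A (D u) + C u (A N) := by
      rw [covDerivCLM_apply, fderiv_clm_apply hA hXd]
      simp [D, hN, hCdef, hAdef, add_comm]
    have h4 : ∀ z, A z = D z + C z N := fun z => rfl
    have h5 : C u N = C N u := christoffelCLM_symm hg hx u N
    simp only [R, sub_apply, ContinuousLinearMap.comp_apply, h3, hdA, h4,
      map_add, add_apply, hsym N u, h5]
    rw [christoffelCLM_symm hg hx (C N u) N]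
    simp only [D]
    abel
  rw [ricci_eq_trace N N R hR]
  have h6 : fderiv ℝ (fun y => traceCLM E (covDerivCLM g X y)) x N
      = traceCLM E (fderiv ℝ (covDerivCLM g X) x N) := by
    change fderiv ℝ (traceCLM E ∘ covDerivCLM g X) x N = _
    rw [((traceCLM E).hasFDerivAt.comp x hA.hasFDerivAt).fderiv]
    rfl
  rw [h6]
  simp only [R, map_sub, traceCLM_comp_comm (C N) D]
  ring

end Connection

/-! ### Level sets: unit normal, acceleration, Weingarten map and the derivative of the mean
curvature. -/

section LevelSets

variable {E : Type*} [NormedAddCommGroup E] [NormedSpace ℝ E] [FiniteDimensional ℝ E]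
variable {q : E → E →L[ℝ] E →L[ℝ] ℝ} {Ω : Set E} {x : E}

lemma covDerivCLM_congr {X Y : E → E} (h : X =ᶠ[𝓝 x] Y) :
    covDerivCLM q X x = covDerivCLM q Y x := by
  simp only [covDerivCLM, h.fderiv_eq, h.eq_of_nhds]

lemma covDerivCLM_add {X Y : E → E} (hX : DifferentiableAt ℝ X x) (hY : DifferentiableAt ℝ Y x) :
    covDerivCLM q (fun y => X y + Y y) x = covDerivCLM q X x + covDerivCLM q Y x := by
  simp only [covDerivCLM, fderiv_fun_add hX hY, map_add]
  abel

lemma covDerivCLM_sub {X Y : E → E} (hX : DifferentiableAt ℝ X x) (hY : DifferentiableAt ℝ Y x) :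
    covDerivCLM q (fun y => X y - Y y) x = covDerivCLM q X x - covDerivCLM q Y x := by
  simp only [covDerivCLM, fderiv_fun_sub hX hY, map_sub]
  abel

lemma covDerivCLM_smul {h : E → ℝ} {X : E → E} (hh : DifferentiableAt ℝ h x)
    (hX : DifferentiableAt ℝ X x) :
    covDerivCLM q (fun y => h y • X y) x
      = (fderiv ℝ h x).smulRight (X x) + h x • covDerivCLM q X x := by
  simp only [covDerivCLM, fderiv_fun_smul hh hX, map_smul]
  module

lemma trace_covDerivCLM_smul {h : E → ℝ} {X : E → E} (hh : DifferentiableAt ℝ h x)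
    (hX : DifferentiableAt ℝ X x) :
    traceCLM E (covDerivCLM q (fun y => h y • X y) x)
      = fderiv ℝ h x (X x) + h x * traceCLM E (covDerivCLM q X x) := by
  rw [covDerivCLM_smul hh hX, map_add, traceCLM_smulRight, map_smul, smul_eq_mul]

/-- The Hessian `D_u D_v h` of a function. -/
def hess (q : E → E →L[ℝ] E →L[ℝ] ℝ) (h : E → ℝ) (x u v : E) : ℝ :=
  fderiv ℝ (fderiv ℝ h) x u v - fderiv ℝ h x (christoffelCLM q x u v)

/-- The Laplacian of a function. -/
def laplacian (q : E → E →L[ℝ] E →L[ℝ] ℝ) (h : E → ℝ) (x : E) : ℝ :=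
  traceCLM E (covDerivCLM q (grad q h) x)

lemma hess_symm (hq : IsMetricOn q Ω) (hx : x ∈ Ω) {h : E → ℝ} (hh : ContDiffAt ℝ ∞ h x)
    (u v : E) : hess q h x u v = hess q h x v u := by
  rw [hess, hess, christoffelCLM_symm hq hx u v,
    (hh.isSymmSndFDerivAt (by simp; norm_cast)).eq u v]

lemma metric_grad (hq : IsMetricOn q Ω) (hx : x ∈ Ω) (h : E → ℝ) :
    q x (grad q h x) = fderiv ℝ h x := (hq.inv x hx).self_apply_inverse _

lemma contDiffOn_grad (hq : IsMetricOn q Ω) {h : E → ℝ} (hh : ContDiffOn ℝ ∞ h Ω) :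
    ContDiffOn ℝ ∞ (grad q h) Ω :=
  (contDiffOn_inverse hq).clm_apply (hh.fderiv_of_isOpen hq.isOpen (by simp))

lemma IsMetricOn.differentiableAt_of (hq : IsMetricOn q Ω) (hx : x ∈ Ω) {F : Type*}
    [NormedAddCommGroup F] [NormedSpace ℝ F] {h : E → F} (hh : ContDiffOn ℝ ∞ h Ω) :
    DifferentiableAt ℝ h x :=
  (hh.contDiffAt (hq.isOpen.mem_nhds hx)).differentiableAt (by simp)

lemma metric_covDerivCLM_grad (hq : IsMetricOn q Ω) (hx : x ∈ Ω) {h : E → ℝ}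
    (hh : ContDiffOn ℝ ∞ h Ω) (u v : E) :
    q x (covDerivCLM q (grad q h) x u) v = hess q h x u v := by
  have he : (fun y => q y (grad q h y)) =ᶠ[𝓝 x] fderiv ℝ h := by
    filter_upwards [hq.isOpen.mem_nhds hx] with y hy using metric_grad hq hy h
  rw [metric_covDerivCLM hq hx (hq.differentiableAt_of hx (contDiffOn_grad hq hh)),
    he.fderiv_eq, metric_grad hq hx, hess]

lemma fderiv_metric_self (hq : IsMetricOn q Ω) (hx : x ∈ Ω) {X : E → E}
    (hX : DifferentiableAt ℝ X x) (u : E) :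
    fderiv ℝ (fun y => q y (X y) (X y)) x u = 2 * q x (covDerivCLM q X x u) (X x) := by
  have h1 : DifferentiableAt ℝ (fun y => q y (X y)) x := (hq.differentiableAt hx).clm_apply hX
  have h2 := metric_covDerivCLM hq hx hX u (X x)
  have h3 : q x (X x) (covDerivCLM q X x u)
      = q x (X x) (fderiv ℝ X x u) + q x (X x) (christoffelCLM q x u (X x)) := by
    rw [covDerivCLM_apply, map_add]
  rw [hq.symm x hx (X x)] at h3
  rw [fderiv_clm_apply h1 hX]
  simp only [add_apply, ContinuousLinearMap.comp_apply, ContinuousLinearMap.flip_apply]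
  linarith

/-- `q` is a Riemannian metric on the open set `Ω` and `r` is a smooth function on `Ω` without
critical points. -/
structure IsFoliationOn (q : E → E →L[ℝ] E →L[ℝ] ℝ) (r : E → ℝ) (Ω : Set E) : Prop where
  metric : IsMetricOn q Ω
  pos : ∀ x ∈ Ω, ∀ u, u ≠ 0 → 0 < q x u u
  smooth : ContDiffOn ℝ ∞ r Ω
  regular : ∀ x ∈ Ω, fderiv ℝ r x ≠ 0

/-- The squared norm `|D r|²` of the gradient. -/
def gradSq (q : E → E →L[ℝ] E →L[ℝ] ℝ) (r : E → ℝ) (x : E) : ℝ :=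
  q x (grad q r x) (grad q r x)

variable {r : E → ℝ}

namespace IsFoliationOn

lemma gradSq_pos (H : IsFoliationOn q r Ω) (hx : x ∈ Ω) : 0 < gradSq q r x := by
  refine H.pos x hx _ fun h => H.regular x hx ?_
  rw [← metric_grad H.metric hx, h, map_zero]

lemma sqrt_gradSq_pos (H : IsFoliationOn q r Ω) (hx : x ∈ Ω) : 0 < √(gradSq q r x) :=
  Real.sqrt_pos.2 (H.gradSq_pos hx)

lemma contDiffOn_gradSq (H : IsFoliationOn q r Ω) : ContDiffOn ℝ ∞ (gradSq q r) Ω :=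
  (H.metric.smooth.clm_apply (contDiffOn_grad H.metric H.smooth)).clm_apply
    (contDiffOn_grad H.metric H.smooth)

lemma contDiffOn_lapse (H : IsFoliationOn q r Ω) :
    ContDiffOn ℝ ∞ (fun y => 1 / √(gradSq q r y)) Ω :=
  contDiffOn_const.div (H.contDiffOn_gradSq.sqrt fun _ hx => (H.gradSq_pos hx).ne')
    fun _ hx => (H.sqrt_gradSq_pos hx).ne'

lemma contDiffOn_unitNormal (H : IsFoliationOn q r Ω) : ContDiffOn ℝ ∞ (unitNormal q r) Ω :=
  H.contDiffOn_lapse.smul (contDiffOn_grad H.metric H.smooth)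

lemma metric_unitNormal (H : IsFoliationOn q r Ω) (hx : x ∈ Ω) :
    q x (unitNormal q r x) = (1 / √(gradSq q r x)) • fderiv ℝ r x := by
  rw [unitNormal, map_smul, ← gradSq, metric_grad H.metric hx]

lemma fderiv_unitNormal (H : IsFoliationOn q r Ω) (hx : x ∈ Ω) :
    fderiv ℝ r x (unitNormal q r x) = √(gradSq q r x) := by
  have h : fderiv ℝ r x (grad q r x) = gradSq q r x := by
    rw [gradSq, metric_grad H.metric hx]
  have hp := H.sqrt_gradSq_pos hx
  rw [unitNormal, map_smul, h, smul_eq_mul, ← gradSq]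
  field_simp
  exact (Real.sq_sqrt (H.gradSq_pos hx).le).symm

lemma metric_unitNormal_self (H : IsFoliationOn q r Ω) (hx : x ∈ Ω) :
    q x (unitNormal q r x) (unitNormal q r x) = 1 := by
  have hp := H.sqrt_gradSq_pos hx
  rw [H.metric_unitNormal hx]
  simp [H.fderiv_unitNormal hx, hp.ne']

lemma fderiv_eq_metric (H : IsFoliationOn q r Ω) (hx : x ∈ Ω) (v : E) :
    fderiv ℝ r x v = √(gradSq q r x) * q x (unitNormal q r x) v := by
  have hp := H.sqrt_gradSq_pos hx
  rw [H.metric_unitNormal hx]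
  simp [hp.ne']

lemma metric_covDerivCLM_unitNormal (H : IsFoliationOn q r Ω) (hx : x ∈ Ω) (u v : E) :
    q x (covDerivCLM q (unitNormal q r) x u) v
      = fderiv ℝ (fun y => 1 / √(gradSq q r y)) x u * fderiv ℝ r x v
        + (1 / √(gradSq q r x)) * hess q r x u v := by
  have h : unitNormal q r = fun y => (1 / √(gradSq q r y)) • grad q r y := rfl
  rw [h, covDerivCLM_smul (H.metric.differentiableAt_of hx H.contDiffOn_lapse)
    (H.metric.differentiableAt_of hx (contDiffOn_grad H.metric H.smooth))]
  simp only [add_apply, ContinuousLinearMap.smulRight_apply, map_add, map_smul, smul_apply,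
    smul_eq_mul, metric_grad H.metric hx, metric_covDerivCLM_grad H.metric hx H.smooth]

lemma metric_covDerivCLM_unitNormal_unitNormal (H : IsFoliationOn q r Ω) (hx : x ∈ Ω) (u : E) :
    q x (covDerivCLM q (unitNormal q r) x u) (unitNormal q r x) = 0 := by
  have h := fderiv_metric_self H.metric hx
    (H.metric.differentiableAt_of hx H.contDiffOn_unitNormal) u
  have he : (fun y => q y (unitNormal q r y) (unitNormal q r y)) =ᶠ[𝓝 x] fun _ => (1 : ℝ) := by
    filter_upwards [H.metric.isOpen.mem_nhds hx] with y hy using H.metric_unitNormal_self hy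
  rw [he.fderiv_eq] at h
  simpa using h.symm

/-- The vector `φ(N) N - φ^♯`, where `N` is the unit normal: minus the tangential part of `φ^♯`. -/
def _root_.CoordGeom.negTangentPart (q : E → E →L[ℝ] E →L[ℝ] ℝ) (r : E → ℝ) (x : E)
    (φ : E →L[ℝ] ℝ) : E :=
  φ (unitNormal q r x) • unitNormal q r x - (q x).inverse φ

lemma metric_negTangentPart (H : IsFoliationOn q r Ω) (hx : x ∈ Ω) (φ : E →L[ℝ] ℝ) (v : E) :
    q x (negTangentPart q r x φ) v
      = φ (unitNormal q r x) * q x (unitNormal q r x) v - φ v := by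
  simp [negTangentPart, (H.metric.inv x hx).self_apply_inverse]

lemma fderiv_negTangentPart (H : IsFoliationOn q r Ω) (hx : x ∈ Ω) (φ : E →L[ℝ] ℝ) :
    fderiv ℝ r x (negTangentPart q r x φ) = 0 := by
  rw [H.fderiv_eq_metric hx, H.metric.symm x hx, H.metric_negTangentPart hx,
    H.metric_unitNormal_self hx]
  simp

/-- The gradient of `r` is purely normal. Hence terms proportional to `dr` in the derivative of `|D
r|²` do not contribute to the acceleration. -/
lemma negTangentPart_fderiv (H : IsFoliationOn q r Ω) (hx : x ∈ Ω) :
    negTangentPart q r x (fderiv ℝ r x) = 0 := by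
  apply (H.metric.inv x hx).injective
  ext v
  rw [H.metric_negTangentPart hx, H.fderiv_unitNormal hx, ← H.fderiv_eq_metric hx]
  simp

lemma contDiffOn_negTangentPart (H : IsFoliationOn q r Ω) {h : E → ℝ}
    (hh : ContDiffOn ℝ ∞ h Ω) :
    ContDiffOn ℝ ∞ (fun y => negTangentPart q r y (fderiv ℝ h y)) Ω :=
  (((hh.fderiv_of_isOpen H.metric.isOpen (by simp)).clm_apply H.contDiffOn_unitNormal).smul
    H.contDiffOn_unitNormal).sub (contDiffOn_grad H.metric hh)

/-- The acceleration `D_N N` of the unit normals. -/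
lemma covDerivCLM_unitNormal_self (H : IsFoliationOn q r Ω) (hx : x ∈ Ω) :
    covDerivCLM q (unitNormal q r) x (unitNormal q r x)
      = (-(1 / (2 * gradSq q r x))) • negTangentPart q r x (fderiv ℝ (gradSq q r) x) := by
  apply (H.metric.inv x hx).injective
  ext v
  have hw := H.gradSq_pos hx
  have hp := H.sqrt_gradSq_pos hx
  have hsq := Real.sq_sqrt hw.le
  -- Orthogonality of `D_v N` and `N` expresses `Hess r(v, N)` through the derivative of `1 / |D
  -- r|`; by symmetry of the Hessian the same term occurs in `D_N N` paired with `v`.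
  have h0 := H.metric_covDerivCLM_unitNormal_unitNormal hx v
  rw [H.metric_covDerivCLM_unitNormal hx, H.fderiv_unitNormal hx,
    hess_symm H.metric hx (H.smooth.contDiffAt (H.metric.isOpen.mem_nhds hx))] at h0
  have hds : ∀ z, fderiv ℝ (fun y => 1 / √(gradSq q r y)) x z
      = -(1 / (2 * gradSq q r x * √(gradSq q r x))) * fderiv ℝ (gradSq q r) x z := fun z => by
    have hd : HasFDerivAt (gradSq q r) (fderiv ℝ (gradSq q r) x) x :=
      (H.metric.differentiableAt_of hx H.contDiffOn_gradSq).hasFDerivAt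
    have := ((hasDerivAt_inv hp.ne').comp_hasFDerivAt x (hd.sqrt hw.ne')).fderiv
    simp only [one_div]
    change fderiv ℝ (Inv.inv ∘ fun y => √(gradSq q r y)) x z = _
    rw [this]
    simp only [smul_apply, smul_eq_mul]
    rw [hsq]
    field_simp
  rw [H.metric_covDerivCLM_unitNormal hx, eq_sub_of_add_eq' h0, map_smul, smul_apply,
    H.metric_negTangentPart hx, hds, hds, H.fderiv_eq_metric hx v, smul_eq_mul]
  field_simp
  ring

variable {α χ : E → ℝ}

/-- The acceleration `D_N N` for a foliation whose lapse is equal to `α` on `{r = 0}`. -/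
lemma covDerivCLM_unitNormal_self_eq (H : IsFoliationOn q r Ω) (hx : x ∈ Ω)
    (hα : ContDiffOn ℝ ∞ α Ω) (hαpos : ∀ y ∈ Ω, 0 < α y) (hχ : ContDiffOn ℝ ∞ χ Ω)
    (hw : ∀ y ∈ Ω, gradSq q r y = (α y ^ 2)⁻¹ + r y * χ y) :
    covDerivCLM q (unitNormal q r) x (unitNormal q r x)
      = (1 / α x) • negTangentPart q r x (fderiv ℝ α x)
        + r x • (-(χ x / (gradSq q r x * α x)) • negTangentPart q r x (fderiv ℝ α x)
          - (1 / (2 * gradSq q r x)) • negTangentPart q r x (fderiv ℝ χ x)) := by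
  have hα0 := hαpos x hx
  have hw0 := H.gradSq_pos hx
  have he : gradSq q r =ᶠ[𝓝 x] fun y => (α y ^ 2)⁻¹ + r y * χ y := by
    filter_upwards [H.metric.isOpen.mem_nhds hx] with y hy using hw y hy
  have hdw : fderiv ℝ (gradSq q r) x
      = (-2 / α x ^ 3) • fderiv ℝ α x + χ x • fderiv ℝ r x + r x • fderiv ℝ χ x := by
    have dα := (H.metric.differentiableAt_of hx hα).hasFDerivAt
    have dχ := (H.metric.differentiableAt_of hx hχ).hasFDerivAt
    have dr := (H.metric.differentiableAt_of hx H.smooth).hasFDerivAt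
    have dαi : HasFDerivAt (fun y => (α y ^ 2)⁻¹) _ x :=
      (hasDerivAt_inv (pow_pos hα0 2).ne').comp_hasFDerivAt x (dα.pow 2)
    rw [he.fderiv_eq, (dαi.fun_add (dr.fun_mul dχ)).fderiv]
    ext v
    simp only [add_apply, smul_apply, smul_eq_mul]
    field_simp
    simp
    ring
  have hlin : negTangentPart q r x (fderiv ℝ (gradSq q r) x)
      = (-2 / α x ^ 3) • negTangentPart q r x (fderiv ℝ α x)
        + r x • negTangentPart q r x (fderiv ℝ χ x) := by
    have h0 := H.negTangentPart_fderiv hx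
    have : negTangentPart q r x (fderiv ℝ (gradSq q r) x)
      = (-2 / α x ^ 3) • negTangentPart q r x (fderiv ℝ α x)
        + χ x • negTangentPart q r x (fderiv ℝ r x)
        + r x • negTangentPart q r x (fderiv ℝ χ x) := by
      rw [hdw]
      simp only [negTangentPart, map_add, map_smul, add_apply, smul_apply]
      module
    rw [this, h0, smul_zero, add_zero]
  rw [H.covDerivCLM_unitNormal_self hx, hlin]
  -- The coefficient `1 / (|D r|² α³)` is split into its value `1 / α` on the surface and a multiple
  -- of `r`, using `r χ = |D r|² - α⁻²`.
  have hc : (-(1 / (2 * gradSq q r x))) * (-2 / α x ^ 3)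
      = 1 / α x + r x * (-(χ x / (gradSq q r x * α x))) := by
    have : r x * χ x = gradSq q r x - (α x ^ 2)⁻¹ := by rw [hw x hx]; ring
    have h2 : r x * (-(χ x / (gradSq q r x * α x)))
        = -((gradSq q r x - (α x ^ 2)⁻¹) / (gradSq q r x * α x)) := by
      rw [← this]; ring
    rw [h2]
    field_simp
    ring
  rw [smul_add, smul_smul, hc]
  module

/-- The divergence of `D_N N` for a foliation whose lapse is equal to `α` on `{r = 0}`. -/
lemma trace_covDerivCLM_acceleration (H : IsFoliationOn q r Ω) (hx : x ∈ Ω) (hr : r x = 0)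
    (hα : ContDiffOn ℝ ∞ α Ω) (hαpos : ∀ y ∈ Ω, 0 < α y) (hχ : ContDiffOn ℝ ∞ χ Ω)
    (hw : ∀ y ∈ Ω, gradSq q r y = (α y ^ 2)⁻¹ + r y * χ y) :
    traceCLM E (covDerivCLM q (fun y => covDerivCLM q (unitNormal q r) y (unitNormal q r y)) x)
      = (hess q α x (unitNormal q r x) (unitNormal q r x)
          + fderiv ℝ α x (unitNormal q r x) * traceCLM E (covDerivCLM q (unitNormal q r) x)
          - laplacian q α x) / α x := by
  have hα0 := hαpos x hx
  set T : E → E := fun y => negTangentPart q r y (fderiv ℝ α y) with hT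
  set V : E → E := fun y => -(χ y / (gradSq q r y * α y)) • T y
          - (1 / (2 * gradSq q r y)) • negTangentPart q r y (fderiv ℝ χ y) with hV
  have cT : ContDiffOn ℝ ∞ T Ω := H.contDiffOn_negTangentPart hα
  have cV : ContDiffOn ℝ ∞ V Ω :=
    (((hχ.div (H.contDiffOn_gradSq.mul hα)
      fun y hy => (mul_pos (H.gradSq_pos hy) (hαpos y hy)).ne').neg).smul cT).sub
      ((contDiffOn_const.div (contDiffOn_const.mul H.contDiffOn_gradSq)
        fun y hy => (mul_pos two_pos (H.gradSq_pos hy)).ne').smul (H.contDiffOn_negTangentPart hχ))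
  have dT := H.metric.differentiableAt_of hx cT
  have dV := H.metric.differentiableAt_of hx cV
  have dα := H.metric.differentiableAt_of hx hα
  have dr := H.metric.differentiableAt_of hx H.smooth
  have dN := H.metric.differentiableAt_of hx H.contDiffOn_unitNormal
  have ddα : DifferentiableAt ℝ (fderiv ℝ α) x :=
    H.metric.differentiableAt_of hx (hα.fderiv_of_isOpen H.metric.isOpen (by simp))
  have dαN : DifferentiableAt ℝ (fun y => fderiv ℝ α y (unitNormal q r y)) x := ddα.clm_apply dN
  have dαi : HasFDerivAt (fun y => 1 / α y) (-(α x ^ 2)⁻¹ • fderiv ℝ α x) x := by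
    simp only [one_div]
    exact (hasDerivAt_inv hα0.ne').comp_hasFDerivAt x dα.hasFDerivAt
  have he : (fun y => covDerivCLM q (unitNormal q r) y (unitNormal q r y))
      =ᶠ[𝓝 x] fun y => (1 / α y) • T y + r y • V y := by
    filter_upwards [H.metric.isOpen.mem_nhds hx] with y hy
    exact H.covDerivCLM_unitNormal_self_eq hy hα hαpos hχ hw
  -- The correction away from the surface is `r V` with `V` tangent to the level sets, so `div(r V)
  -- = V(r) + r div V` vanishes where `r = 0`. Prescribing the lapse on the surface alone is
  -- therefore enough.
  have hrV : fderiv ℝ r x (V x) = 0 := by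
    simp [hV, hT, H.fderiv_negTangentPart hx]
  -- `N(N α) = Hess α(N, N) + dα(D_N N)`. The last term cancels against the derivative of `1 / α` in
  -- the divergence of `T / α`.
  have hNN : fderiv ℝ (fun y => fderiv ℝ α y (unitNormal q r y)) x (unitNormal q r x)
      = hess q α x (unitNormal q r x) (unitNormal q r x) + fderiv ℝ α x ((1 / α x) • T x) := by
    have h1 : covDerivCLM q (unitNormal q r) x (unitNormal q r x) = (1 / α x) • T x := by
      have := he.eq_of_nhds
      simpa [hr] using this
    rw [← h1, covDerivCLM_apply, hess, fderiv_clm_apply ddα dN]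
    simp
    ring
  have hTr : traceCLM E (covDerivCLM q T x)
      = hess q α x (unitNormal q r x) (unitNormal q r x) + fderiv ℝ α x ((1 / α x) • T x)
        + fderiv ℝ α x (unitNormal q r x) * traceCLM E (covDerivCLM q (unitNormal q r) x)
        - laplacian q α x := by
    rw [← hNN]
    have : T = fun y => fderiv ℝ α y (unitNormal q r y) • unitNormal q r y - grad q α y := rfl
    rw [this, covDerivCLM_sub (dαN.fun_smul dN)
      (H.metric.differentiableAt_of hx (contDiffOn_grad H.metric hα)), map_sub,
      trace_covDerivCLM_smul dαN dN, laplacian]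
  rw [covDerivCLM_congr he, covDerivCLM_add (dαi.differentiableAt.fun_smul dT) (dr.fun_smul dV),
    map_add, trace_covDerivCLM_smul dαi.differentiableAt dT, trace_covDerivCLM_smul dr dV, hrV, hr,
    dαi.fderiv, hTr]
  simp only [smul_apply, map_smul, smul_eq_mul]
  field_simp
  ring

/-- The Weingarten map `u ↦ D_{h u} N`. -/
def _root_.CoordGeom.weingarten (q : E → E →L[ℝ] E →L[ℝ] ℝ) (r : E → ℝ) (x : E) : E →L[ℝ] E :=
  covDerivCLM q (unitNormal q r) x - (q x (unitNormal q r x)).smulRight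
    (covDerivCLM q (unitNormal q r) x (unitNormal q r x))

lemma extrinsicCurvature_eq_weingarten (H : IsFoliationOn q r Ω) (hx : x ∈ Ω) (u v : E) :
    extrinsicCurvature q r x u v = q x (weingarten q r x u) v := by
  rw [extrinsicCurvature, ← covDerivCLM_eq H.metric hx]
  simp [tangentProj, weingarten, H.metric_covDerivCLM_unitNormal_unitNormal hx]

lemma metric_tangentProj (H : IsFoliationOn q r Ω) (hx : x ∈ Ω) (u : E) :
    fderiv ℝ r x (tangentProj q r x u) = 0 := by
  rw [H.fderiv_eq_metric hx]
  simp [tangentProj, H.metric_unitNormal_self hx]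

lemma extrinsicCurvature_eq_hess (H : IsFoliationOn q r Ω) (hx : x ∈ Ω) (u v : E) :
    extrinsicCurvature q r x u v
      = (1 / √(gradSq q r x)) * hess q r x (tangentProj q r x u) (tangentProj q r x v) := by
  rw [extrinsicCurvature, ← covDerivCLM_eq H.metric hx, H.metric_covDerivCLM_unitNormal hx,
    H.metric_tangentProj hx]
  simp

/-- On tangential parts the form is a multiple of the Hessian of `r`, which is symmetric because the
connection is torsion-free. -/
lemma weingarten_symm (H : IsFoliationOn q r Ω) (hx : x ∈ Ω) (u v : E) :
    q x (weingarten q r x u) v = q x u (weingarten q r x v) := by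
  rw [H.metric.symm x hx u, ← H.extrinsicCurvature_eq_weingarten hx,
    ← H.extrinsicCurvature_eq_weingarten hx, H.extrinsicCurvature_eq_hess hx,
    H.extrinsicCurvature_eq_hess hx,
    hess_symm H.metric hx (H.smooth.contDiffAt (H.metric.isOpen.mem_nhds hx))]

lemma meanCurvature_eq_trace_weingarten (H : IsFoliationOn q r Ω) (hx : x ∈ Ω) :
    meanCurvature q r x = traceCLM E (weingarten q r x) := by
  rw [meanCurvature, ← metricTrace_eq_traceCLM (q x) (H.metric.inv x hx) (H.metric.symm x hx)]
  congr 1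
  ext u v
  exact H.extrinsicCurvature_eq_weingarten hx u v

lemma trace_weingarten (H : IsFoliationOn q r Ω) (hx : x ∈ Ω) :
    traceCLM E (weingarten q r x) = traceCLM E (covDerivCLM q (unitNormal q r) x) := by
  rw [weingarten, map_sub, traceCLM_smulRight, H.metric.symm x hx,
    H.metric_covDerivCLM_unitNormal_unitNormal hx, sub_zero]

/-- `A = DN` takes values orthogonal to `N`, so the rank-one difference `P = N^♭ ⊗ A N` satisfies `P
A = 0` and `P² = 0`; `A P` is traceless by cyclicity. The Bochner term `tr(A²)` thus sees only
principal curvatures. -/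
lemma trace_weingarten_comp_self (H : IsFoliationOn q r Ω) (hx : x ∈ Ω) :
    traceCLM E (weingarten q r x ∘L weingarten q r x)
      = traceCLM E (covDerivCLM q (unitNormal q r) x ∘L covDerivCLM q (unitNormal q r) x) := by
  set A := covDerivCLM q (unitNormal q r) x with hA
  set N := unitNormal q r x with hN
  set P : E →L[ℝ] E := (q x N).smulRight (A N) with hP
  have hNA : ∀ u, q x N (A u) = 0 := fun u => by
    rw [H.metric.symm x hx]; exact H.metric_covDerivCLM_unitNormal_unitNormal hx u
  have hPA : P ∘L A = 0 := by ext u; simp [hP, hNA]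
  have hPP : P ∘L P = 0 := by ext u; simp [hP, hNA]
  have hK : weingarten q r x = A - P := rfl
  rw [hK, ContinuousLinearMap.sub_comp, ContinuousLinearMap.comp_sub, ContinuousLinearMap.comp_sub,
    hPA, hPP, map_sub, map_sub, traceCLM_comp_comm A P, hPA]
  simp

/-- The normal derivative of the mean curvature in terms of the Weingarten map, for a foliation
whose lapse is equal to `α` on `{r = 0}`. -/
theorem normalDerivMeanCurvature_eq (H : IsFoliationOn q r Ω) (hx : x ∈ Ω) (hr : r x = 0)
    (hα : ContDiffOn ℝ ∞ α Ω) (hαpos : ∀ y ∈ Ω, 0 < α y) (hχ : ContDiffOn ℝ ∞ χ Ω)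
    (hw : ∀ y ∈ Ω, gradSq q r y = (α y ^ 2)⁻¹ + r y * χ y)
    (hRic : α x * ricci q x (unitNormal q r x) (unitNormal q r x)
      = hess q α x (unitNormal q r x) (unitNormal q r x) - laplacian q α x) :
    normalDerivMeanCurvature q r x
      = fderiv ℝ α x (unitNormal q r x) / α x * traceCLM E (weingarten q r x)
        - traceCLM E (weingarten q r x ∘L weingarten q r x) := by
  have hα0 := hαpos x hx
  have he : meanCurvature q r =ᶠ[𝓝 x] fun y => traceCLM E (covDerivCLM q (unitNormal q r) y) := by
    filter_upwards [H.metric.isOpen.mem_nhds hx] with y hy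
    rw [H.meanCurvature_eq_trace_weingarten hy, H.trace_weingarten hy]
  rw [normalDerivMeanCurvature, he.fderiv_eq, fderiv_div H.metric hx H.contDiffOn_unitNormal,
    H.trace_covDerivCLM_acceleration hx hr hα hαpos hχ hw, H.trace_weingarten hx,
    H.trace_weingarten_comp_self hx]
  have : ricci q x (unitNormal q r x) (unitNormal q r x)
      = (hess q α x (unitNormal q r x) (unitNormal q r x) - laplacian q α x) / α x := by
    rw [← hRic]; field_simp
  rw [this]
  ring

/-- If each principal curvature `κ` in the sense of an eigenvalue satisfies `0 ≤ κ ≤ lam`, then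
`0 ≤ tr K` and `0 ≤ lam (tr K) - tr (K²)` for the Weingarten map `K`. -/
theorem trace_weingarten_nonneg (H : IsFoliationOn q r Ω) (hx : x ∈ Ω) (lam : ℝ)
    (hκ : ∀ κ, IsPrincipalCurvature q r x κ → 0 ≤ κ)
    (hlam : ∀ u, fderiv ℝ r x u = 0 → extrinsicCurvature q r x u u ≤ lam * q x u u) :
    0 ≤ traceCLM E (weingarten q r x) ∧
      0 ≤ lam * traceCLM E (weingarten q r x)
        - traceCLM E (weingarten q r x ∘L weingarten q r x) ∧
      ((∃ u v, extrinsicCurvature q r x u v ≠ 0) → 0 < traceCLM E (weingarten q r x)) := by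
  set K := weingarten q r x with hK
  obtain ⟨e, κ, he⟩ := exists_eigenbasis (ContinuousLinearMap.toLinearMap₁₂ (q x))
    (H.metric.symm x hx) (H.pos x hx) (K : E →ₗ[ℝ] E) (H.weingarten_symm hx)
  have he' : ∀ i, K (e i) = κ i • e i := he
  have htr : traceCLM E K = ∑ i, κ i := trace_eq_sum_of_eigenbasis e _ κ he
  have htr2 : traceCLM E (K ∘L K) = ∑ i, κ i * κ i :=
    trace_eq_sum_of_eigenbasis e _ _ fun i => by simp [he', smul_smul]
  -- The eigenbasis is one of the whole space, including the normal direction. Since `K N = 0` and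
  -- `K` is symmetric, an eigenvector with nonzero eigenvalue is orthogonal to `N`, so it gives a
  -- principal curvature. Zero eigenvalues contribute nothing to either sum, whatever the sign of
  -- `lam`.
  have hcase : ∀ i, κ i = 0 ∨ (0 ≤ κ i ∧ κ i ≤ lam) := fun i => by
    by_cases h0 : κ i = 0
    · exact Or.inl h0
    right
    have htan : fderiv ℝ r x (e i) = 0 := by
      have h1 : q x (K (e i)) (unitNormal q r x) = 0 := by
        rw [H.weingarten_symm hx, ← hK]
        have : K (unitNormal q r x) = 0 := by
          simp [hK, weingarten, H.metric_unitNormal_self hx]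
        rw [this, map_zero]
      rw [he', H.metric.symm x hx] at h1
      rw [H.fderiv_eq_metric hx]
      simp only [map_smul, smul_eq_mul, mul_eq_zero, h0, false_or] at h1
      rw [h1, mul_zero]
    have hpos := H.pos x hx (e i) (e.ne_zero i)
    have hex : ∀ v, extrinsicCurvature q r x (e i) v = κ i * q x (e i) v := fun v => by
      rw [H.extrinsicCurvature_eq_weingarten hx, ← hK, he']
      simp
    refine ⟨hκ _ ⟨e i, e.ne_zero i, htan, fun v _ => hex v⟩, ?_⟩
    have := hlam (e i) htan
    rw [hex] at this
    exact le_of_mul_le_mul_right this hpos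
  have hnn : ∀ i, 0 ≤ κ i := fun i => by
    rcases hcase i with h | h
    · exact h.ge
    · exact h.1
  rw [htr, htr2]
  refine ⟨Finset.sum_nonneg fun i _ => hnn i, ?_, ?_⟩
  · rw [Finset.mul_sum, ← Finset.sum_sub_distrib]
    refine Finset.sum_nonneg fun i _ => ?_
    rcases hcase i with h | h
    · simp [h]
    · nlinarith [h.1, h.2]
  · rintro ⟨u, v, huv⟩
    refine lt_of_le_of_ne (Finset.sum_nonneg fun i _ => hnn i) fun h => huv ?_
    have hz : ∀ i, κ i = 0 := fun i =>
      (Finset.sum_eq_zero_iff_of_nonneg fun i _ => hnn i).1 h.symm i (Finset.mem_univ i)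
    have hK0 : (K : E →ₗ[ℝ] E) = 0 := e.ext fun i => by simp [he', hz]
    rw [H.extrinsicCurvature_eq_weingarten hx, ← hK]
    have : K u = 0 := LinearMap.congr_fun hK0 u
    simp [this]

end IsFoliationOn

end LevelSets

/-! ### Replacing the defining function `f` by `f ρ`. -/

section Rescaling

variable {E : Type*} [NormedAddCommGroup E] [NormedSpace ℝ E] [FiniteDimensional ℝ E]
variable {q : E → E →L[ℝ] E →L[ℝ] ℝ} {Ω : Set E} {x : E} {f ρ α : E → ℝ}

lemma gradSq_eq_fderiv (hq : IsMetricOn q Ω) (hx : x ∈ Ω) (h : E → ℝ) :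
    gradSq q h x = fderiv ℝ h x (grad q h x) := by
  rw [gradSq, metric_grad hq hx]

lemma fderiv_grad_comm (hq : IsMetricOn q Ω) (hx : x ∈ Ω) (h k : E → ℝ) :
    fderiv ℝ h x (grad q k x) = fderiv ℝ k x (grad q h x) := by
  rw [← metric_grad hq hx, ← metric_grad hq hx, hq.symm x hx]

lemma gradSq_mul (hq : IsMetricOn q Ω) (hx : x ∈ Ω) (hf : DifferentiableAt ℝ f x)
    (hρ : DifferentiableAt ℝ ρ x) :
    gradSq q (fun y => f y * ρ y) x = ρ x ^ 2 * gradSq q f x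
      + 2 * f x * ρ x * fderiv ℝ f x (grad q ρ x) + f x ^ 2 * gradSq q ρ x := by
  simp only [gradSq_eq_fderiv hq hx]
  have h : fderiv ℝ (fun y => f y * ρ y) x = f x • fderiv ℝ ρ x + ρ x • fderiv ℝ f x :=
    fderiv_fun_mul hf hρ
  have hg : grad q (fun y => f y * ρ y) x = f x • grad q ρ x + ρ x • grad q f x := by
    simp only [grad, h, map_add, map_smul]
  rw [h, hg]
  simp only [add_apply, smul_apply, map_add, map_smul, smul_eq_mul,
    fderiv_grad_comm hq hx ρ f]
  ring

/-- The squared gradient of `r = f ρ`, `ρ = 1 / (α |D f|)`, is equal to `1 / α²` on `{r = 0}`. -/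
lemma IsFoliationOn.exists_gradSq_eq (H : IsFoliationOn q f Ω)
    (hαpos : ∀ y ∈ Ω, 0 < α y) (hρ : ContDiffOn ℝ ∞ ρ Ω)
    (hρeq : ∀ y ∈ Ω, ρ y = (α y * √(gradSq q f y))⁻¹) :
    ∃ χ : E → ℝ, ContDiffOn ℝ ∞ χ Ω ∧
      ∀ y ∈ Ω, gradSq q (fun y => f y * ρ y) y = (α y ^ 2)⁻¹ + f y * ρ y * χ y := by
  have hρpos : ∀ y ∈ Ω, 0 < ρ y := fun y hy => by
    rw [hρeq y hy]
    exact inv_pos.2 (mul_pos (hαpos y hy) (H.sqrt_gradSq_pos hy))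
  have hdρ : ContDiffOn ℝ ∞ (fderiv ℝ ρ) Ω := hρ.fderiv_of_isOpen H.metric.isOpen (by simp)
  have hdf : ContDiffOn ℝ ∞ (fderiv ℝ f) Ω := H.smooth.fderiv_of_isOpen H.metric.isOpen (by simp)
  have hgρ := contDiffOn_grad H.metric hρ
  -- In `|D(f ρ)|² = ρ² |D f|² + 2 f ρ ⟨D f, D ρ⟩ + f² |D ρ|²` the first term is `α⁻²`; dividing the
  -- others by `f ρ` gives `χ`.
  refine ⟨fun y => 2 * fderiv ℝ f y (grad q ρ y) + f y / ρ y * fderiv ℝ ρ y (grad q ρ y),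
    (contDiffOn_const.mul (hdf.clm_apply hgρ)).add
      ((H.smooth.div hρ fun y hy => (hρpos y hy).ne').mul (hdρ.clm_apply hgρ)), fun y hy => ?_⟩
  have h0 := (hρpos y hy).ne'
  have hα0 := hαpos y hy
  have hw := H.gradSq_pos hy
  have h1 : ρ y ^ 2 * gradSq q f y = (α y ^ 2)⁻¹ := by
    rw [hρeq y hy, inv_pow, mul_pow, Real.sq_sqrt hw.le]
    field_simp
  rw [gradSq_mul H.metric hy (H.metric.differentiableAt_of hy H.smooth)
    (H.metric.differentiableAt_of hy hρ), h1, gradSq_eq_fderiv H.metric hy ρ]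
  field_simp
  ring

section ZeroSet

variable (hq : IsMetricOn q Ω) (hx : x ∈ Ω) (hf : ContDiffOn ℝ ∞ f Ω) (hρ : ContDiffOn ℝ ∞ ρ Ω)
  (h0 : f x = 0)

include hq hx hf hρ h0

lemma fderiv_mul_of_eq_zero : fderiv ℝ (fun y => f y * ρ y) x = ρ x • fderiv ℝ f x := by
  rw [fderiv_fun_mul (hq.differentiableAt_of hx hf) (hq.differentiableAt_of hx hρ), h0]
  simp

/-- The term with the Hessian of `ρ` carries the factor `f = 0`, and both cross terms carry `df`. On
tangent vectors only the factor `ρ` remains, and it cancels against the norm of the gradient. -/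
lemma hess_mul_of_eq_zero (u v : E) :
    hess q (fun y => f y * ρ y) x u v = ρ x * hess q f x u v
      + fderiv ℝ f x u * fderiv ℝ ρ x v + fderiv ℝ ρ x u * fderiv ℝ f x v := by
  have df := hq.differentiableAt_of hx hf
  have dρ := hq.differentiableAt_of hx hρ
  have ddf : DifferentiableAt ℝ (fderiv ℝ f) x :=
    hq.differentiableAt_of hx (hf.fderiv_of_isOpen (m := ∞) hq.isOpen (by simp))
  have ddρ : DifferentiableAt ℝ (fderiv ℝ ρ) x :=
    hq.differentiableAt_of hx (hρ.fderiv_of_isOpen (m := ∞) hq.isOpen (by simp))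
  have he : fderiv ℝ (fun y => f y * ρ y)
      =ᶠ[𝓝 x] fun y => f y • fderiv ℝ ρ y + ρ y • fderiv ℝ f y := by
    filter_upwards [hq.isOpen.mem_nhds hx] with y hy
    exact fderiv_fun_mul (hq.differentiableAt_of hy hf) (hq.differentiableAt_of hy hρ)
  rw [hess, he.fderiv_eq, fderiv_fun_add (df.fun_smul ddρ) (dρ.fun_smul ddf),
    fderiv_fun_smul df ddρ, fderiv_fun_smul dρ ddf, fderiv_mul_of_eq_zero hq hx hf hρ h0, hess, h0]
  simp
  ring

lemma gradSq_mul_of_eq_zero :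
    gradSq q (fun y => f y * ρ y) x = ρ x ^ 2 * gradSq q f x := by
  rw [gradSq_mul hq hx (hq.differentiableAt_of hx hf) (hq.differentiableAt_of hx hρ), h0]
  ring

lemma sqrt_gradSq_mul_of_eq_zero (hpos : 0 < ρ x) :
    √(gradSq q (fun y => f y * ρ y) x) = ρ x * √(gradSq q f x) := by
  rw [gradSq_mul_of_eq_zero hq hx hf hρ h0, Real.sqrt_mul (by positivity), Real.sqrt_sq hpos.le]

lemma unitNormal_mul_of_eq_zero (hpos : 0 < ρ x) :
    unitNormal q (fun y => f y * ρ y) x = unitNormal q f x := by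
  rw [unitNormal, ← gradSq, sqrt_gradSq_mul_of_eq_zero hq hx hf hρ h0 hpos, unitNormal, ← gradSq,
    grad, fderiv_mul_of_eq_zero hq hx hf hρ h0, map_smul, smul_smul, grad]
  congr 1
  field_simp

end ZeroSet

/-- The extrinsic curvature of `{f = 0}` does not depend on the defining function. -/
lemma extrinsicCurvature_mul_of_eq_zero (H : IsFoliationOn q f Ω)
    (Hr : IsFoliationOn q (fun y => f y * ρ y) Ω) (hx : x ∈ Ω)
    (hρ : ContDiffOn ℝ ∞ ρ Ω) (h0 : f x = 0) (hpos : 0 < ρ x) (u v : E) :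
    extrinsicCurvature q (fun y => f y * ρ y) x u v = extrinsicCurvature q f x u v := by
  have hN := unitNormal_mul_of_eq_zero H.metric hx H.smooth hρ h0 hpos
  have ht : tangentProj q (fun y => f y * ρ y) x = tangentProj q f x := by
    ext u
    simp only [tangentProj, hN]
  have hp := H.sqrt_gradSq_pos hx
  rw [Hr.extrinsicCurvature_eq_hess hx, H.extrinsicCurvature_eq_hess hx, ht,
    hess_mul_of_eq_zero H.metric hx H.smooth hρ h0,
    sqrt_gradSq_mul_of_eq_zero H.metric hx H.smooth hρ h0 hpos, H.metric_tangentProj hx,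
    H.metric_tangentProj hx]
  field_simp
  ring

lemma isPrincipalCurvature_mul_of_eq_zero (H : IsFoliationOn q f Ω)
    (Hr : IsFoliationOn q (fun y => f y * ρ y) Ω) (hx : x ∈ Ω)
    (hρ : ContDiffOn ℝ ∞ ρ Ω) (h0 : f x = 0) (hpos : 0 < ρ x) {κ : ℝ}
    (h : IsPrincipalCurvature q (fun y => f y * ρ y) x κ) : IsPrincipalCurvature q f x κ := by
  have hd : ∀ v, fderiv ℝ (fun y => f y * ρ y) x v = 0 ↔ fderiv ℝ f x v = 0 := fun v => by
    rw [fderiv_mul_of_eq_zero H.metric hx H.smooth hρ h0]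
    simp [hpos.ne']
  obtain ⟨u, hu, hdu, huv⟩ := h
  refine ⟨u, hu, (hd u).1 hdu, fun v hv => ?_⟩
  rw [← extrinsicCurvature_mul_of_eq_zero H Hr hx hρ h0 hpos]
  exact huv v ((hd v).2 hv)

/-- The signs of the mean curvature of the level sets of `f / (α |D f|)` and of its normal
derivative at a point of the surface. -/
theorem curvature_conditions (H : IsFoliationOn q f Ω)
    (Hr : IsFoliationOn q (fun y => f y * ρ y) Ω) (hx : x ∈ Ω) (h0 : f x = 0)
    (hα : ContDiffOn ℝ ∞ α Ω) (hαpos : ∀ y ∈ Ω, 0 < α y) (hρ : ContDiffOn ℝ ∞ ρ Ω)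
    (hρeq : ∀ y ∈ Ω, ρ y = (α y * √(gradSq q f y))⁻¹)
    (hRic : α x * ricci q x (unitNormal q f x) (unitNormal q f x)
      = hess q α x (unitNormal q f x) (unitNormal q f x) - laplacian q α x)
    (hκ : ∀ κ, IsPrincipalCurvature q f x κ → 0 ≤ κ)
    (hhess : ∀ u, fderiv ℝ f x u = 0 →
      hess q f x u u ≤ fderiv ℝ f x (grad q α x) / α x * q x u u) :
    0 ≤ meanCurvature q (fun y => f y * ρ y) x ∧
      0 ≤ normalDerivMeanCurvature q (fun y => f y * ρ y) x ∧
      ((∃ u v, extrinsicCurvature q f x u v ≠ 0) →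
        0 < meanCurvature q (fun y => f y * ρ y) x) := by
  have hpos : 0 < ρ x := by
    rw [hρeq x hx]
    exact inv_pos.2 (mul_pos (hαpos x hx) (H.sqrt_gradSq_pos hx))
  have hN := unitNormal_mul_of_eq_zero H.metric hx H.smooth hρ h0 hpos
  have hex := extrinsicCurvature_mul_of_eq_zero H Hr hx hρ h0 hpos
  obtain ⟨χ, hχ, hw⟩ := H.exists_gradSq_eq hαpos hρ hρeq
  rw [← hN] at hRic
  rw [Hr.normalDerivMeanCurvature_eq hx (by simp [h0]) hα hαpos hχ hw hRic,
    Hr.meanCurvature_eq_trace_weingarten hx]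
  obtain ⟨h1, h2, h3⟩ := Hr.trace_weingarten_nonneg hx
    (fderiv ℝ α x (unitNormal q (fun y => f y * ρ y) x) / α x)
    (fun κ h => hκ κ (isPrincipalCurvature_mul_of_eq_zero H Hr hx hρ h0 hpos h))
    -- Dividing the Hessian bound by `|D f|` turns `Hess f(u, u)` into the extrinsic curvature and
    -- `df(grad α)` into the normal derivative of `α`.
    (fun u hu => by
      have hu' : fderiv ℝ f x u = 0 := by
        rw [fderiv_mul_of_eq_zero H.metric hx H.smooth hρ h0] at hu
        simpa [hpos.ne'] using hu
      have ht : tangentProj q f x u = u := by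
        have h := H.fderiv_eq_metric hx u
        rw [hu', eq_comm, mul_eq_zero, or_iff_right (H.sqrt_gradSq_pos hx).ne'] at h
        simp [tangentProj, h]
      have hp := H.sqrt_gradSq_pos hx
      rw [hex, H.extrinsicCurvature_eq_hess hx, ht, hN]
      have h := mul_le_mul_of_nonneg_left (hhess u hu') (one_div_nonneg.2 hp.le)
      refine h.trans_eq ?_
      rw [fderiv_grad_comm H.metric hx, unitNormal, map_smul, ← gradSq, smul_eq_mul]
      ring)
  refine ⟨h1, h2, fun ⟨u, v, huv⟩ => h3 ⟨u, v, ?_⟩⟩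
  rwa [hex]

end Rescaling

/-! ### Connection and Ricci tensor of `-α² dt² + q`. -/

section StaticMetric

variable {E : Type*} [NormedAddCommGroup E] [NormedSpace ℝ E] [FiniteDimensional ℝ E]
variable {q : E → E →L[ℝ] E →L[ℝ] ℝ} {α : E → ℝ} {Ω : Set E}

/-- The metric `-α² dt² + q` on `ℝ × E`. -/
def staticMetric (q : E → E →L[ℝ] E →L[ℝ] ℝ) (α : E → ℝ) (z : ℝ × E) :
    ℝ × E →L[ℝ] ℝ × E →L[ℝ] ℝ :=
  (q z.2).bilinearComp (ContinuousLinearMap.snd ℝ ℝ E) (ContinuousLinearMap.snd ℝ ℝ E)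
    - (α z.2 ^ 2) • (ContinuousLinearMap.fst ℝ ℝ E).smulRight (ContinuousLinearMap.fst ℝ ℝ E)

lemma staticMetric_apply (z u v : ℝ × E) :
    staticMetric q α z u v = q z.2 u.2 v.2 - α z.2 ^ 2 * (u.1 * v.1) := by
  simp [staticMetric]

lemma contDiffOn_staticMetric (hq : ContDiffOn ℝ ∞ q Ω) (hα : ContDiffOn ℝ ∞ α Ω) :
    ContDiffOn ℝ ∞ (staticMetric q α) (univ ×ˢ Ω) := by
  have hm : MapsTo (Prod.snd : ℝ × E → E) (univ ×ˢ Ω) Ω := fun z hz => hz.2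
  have h1 : ContDiffOn ℝ ∞ (fun z : ℝ × E => q z.2) (univ ×ˢ Ω) :=
    hq.comp contDiff_snd.contDiffOn hm
  have h2 : ContDiffOn ℝ ∞ (fun z : ℝ × E => α z.2) (univ ×ˢ Ω) :=
    hα.comp contDiff_snd.contDiffOn hm
  rw [contDiffOn_clm_apply]
  intro u
  rw [contDiffOn_clm_apply]
  intro v
  simp only [staticMetric_apply]
  exact ((h1.clm_apply contDiffOn_const).clm_apply contDiffOn_const).sub
    ((h2.pow 2).mul contDiffOn_const)

variable (hq : IsMetricOn q Ω) (hα : ContDiffOn ℝ ∞ α Ω) (hαpos : ∀ y ∈ Ω, 0 < α y)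

include hq hα hαpos

lemma isMetricOn_staticMetric : IsMetricOn (staticMetric q α) (univ ×ˢ Ω) where
  isOpen := isOpen_univ.prod hq.isOpen
  smooth := contDiffOn_staticMetric hq.smooth hα
  symm z hz u v := by
    rw [staticMetric_apply, staticMetric_apply, hq.symm _ hz.2]
    ring
  inv z hz := isInvertible_of_injective _ fun u hu => by
    have hα0 := hαpos _ hz.2
    have h1 := hu (1, 0)
    have h2 : q z.2 u.2 = 0 := by
      ext v
      simpa [staticMetric_apply] using hu (0, v)
    simp only [staticMetric_apply, map_zero, mul_one, zero_sub, neg_eq_zero, mul_eq_zero] at h1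
    refine Prod.ext (h1.resolve_left (by positivity)) ((hq.inv _ hz.2).injective ?_)
    simp [h2]

lemma fderiv_staticMetric {z : ℝ × E} (hz : z.2 ∈ Ω) (u v w : ℝ × E) :
    fderiv ℝ (staticMetric q α) z u v w
      = fderiv ℝ q z.2 u.2 v.2 w.2 - 2 * α z.2 * fderiv ℝ α z.2 u.2 * (v.1 * w.1) := by
  have hG := isMetricOn_staticMetric hq hα hαpos
  have hd : DifferentiableAt ℝ (staticMetric q α) z := hG.differentiableAt ⟨mem_univ _, hz⟩
  have h1 : fderiv ℝ (staticMetric q α) z u v w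
      = fderiv ℝ (fun y => staticMetric q α y v w) z u := by
    rw [fderiv_clm_apply (hd.clm_apply (by fun_prop)) (by fun_prop),
      fderiv_clm_apply hd (by fun_prop)]
    simp
  have dq := (hq.differentiableAt hz).hasFDerivAt
  have dα := (hq.differentiableAt_of hz hα).hasFDerivAt
  have hs : HasFDerivAt (Prod.snd : ℝ × E → E) (ContinuousLinearMap.snd ℝ ℝ E) z :=
    hasFDerivAt_snd
  have dq' : HasFDerivAt (fun y : ℝ × E => q y.2) _ z := dq.comp z hs
  have dα' : HasFDerivAt (fun y : ℝ × E => α y.2) _ z := dα.comp z hs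
  have h2 : HasFDerivAt (fun y : ℝ × E => q y.2 v.2 w.2 - α y.2 ^ 2 * (v.1 * w.1)) _ z :=
    ((dq'.clm_apply (hasFDerivAt_const v.2 z)).clm_apply (hasFDerivAt_const w.2 z)).fun_sub
      ((dα'.pow 2).mul_const (v.1 * w.1))
  rw [h1]
  simp only [staticMetric_apply]
  rw [h2.fderiv]
  simp
  ring

/-- The Christoffel symbols of a static metric. -/
lemma christoffelCLM_staticMetric {z : ℝ × E} (hz : z.2 ∈ Ω) (u v : ℝ × E) :
    christoffelCLM (staticMetric q α) z u v
      = ((u.1 * fderiv ℝ α z.2 v.2 + v.1 * fderiv ℝ α z.2 u.2) / α z.2,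
        christoffelCLM q z.2 u.2 v.2 + (u.1 * v.1 * α z.2) • grad q α z.2) := by
  have hG := isMetricOn_staticMetric hq hα hαpos
  have hz' : z ∈ univ ×ˢ Ω := ⟨mem_univ _, hz⟩
  have hα0 := hαpos _ hz
  apply (hG.inv z hz').injective
  refine ContinuousLinearMap.ext fun w => ?_
  rw [christoffel_koszul' hG hz', staticMetric_apply, map_add, map_smul, metric_grad hq hz,
    add_apply, christoffel_koszul' hq hz]
  simp only [fderiv_staticMetric hq hα hαpos hz, smul_apply, smul_eq_mul]
  field_simp
  ring

omit hq hα hαpos in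
lemma fderiv_christoffelCLM_apply {g : E → E →L[ℝ] E →L[ℝ] ℝ} (hg : IsMetricOn g Ω) {x : E}
    (hx : x ∈ Ω) (u v w : E) :
    fderiv ℝ (christoffelCLM g) x u v w = fderiv ℝ (fun y => christoffelCLM g y v w) x u := by
  have hC := hg.differentiableAt_of hx (contDiffOn_christoffelCLM hg)
  rw [fderiv_clm_apply (hC.clm_apply (by fun_prop)) (by fun_prop),
    fderiv_clm_apply hC (by fun_prop)]
  simp

/-- The map `u ↦ R(u, v) w`. -/
def riemannCLM (g : E → E →L[ℝ] E →L[ℝ] ℝ) (x v w : E) : E →L[ℝ] E :=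
  ((fderiv ℝ (christoffelCLM g) x).flip v).flip w - (fderiv ℝ (christoffelCLM g) x v).flip w
    + (christoffelCLM g x).flip (christoffelCLM g x v w)
    - christoffelCLM g x v ∘L (christoffelCLM g x).flip w

omit hα hαpos in
lemma riemannCLM_apply {x : E} (hx : x ∈ Ω) (u v w : E) :
    riemannCLM q x v w u = riemann q x u v w := by
  rw [riemann_eq hq hx]
  rfl

omit hq hα hαpos in
-- The curvature operators whose traces are needed preserve the splitting into time and space, so
-- their traces add up blockwise.
lemma traceCLM_prod (c : ℝ) (L : E →L[ℝ] E) (M : ℝ × E →L[ℝ] ℝ × E)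
    (hM : ∀ u, M u = (c * u.1, L u.2)) : traceCLM (ℝ × E) M = c + traceCLM E L := by
  have h : (M : ℝ × E →ₗ[ℝ] ℝ × E)
      = (c • LinearMap.id : ℝ →ₗ[ℝ] ℝ).prodMap (L : E →ₗ[ℝ] E) := by
    apply LinearMap.ext
    intro u
    simp [hM]
  rw [traceCLM_apply, h, LinearMap.trace_prodMap', map_smul, LinearMap.trace_id]
  simp [traceCLM_apply]

/-- The time-time component of the Ricci tensor of a static metric. -/
theorem ricci_staticMetric_time {z : ℝ × E} (hz : z.2 ∈ Ω) (c : ℝ) :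
    ricci (staticMetric q α) z (c, 0) (c, 0) = c ^ 2 * (α z.2 * laplacian q α z.2) := by
  have hG := isMetricOn_staticMetric hq hα hαpos
  have hz' : z ∈ univ ×ˢ Ω := ⟨mem_univ _, hz⟩
  have hα0 := hαpos _ hz
  have dα := hq.differentiableAt_of hz hα
  have dg := hq.differentiableAt_of hz (contDiffOn_grad hq hα)
  have hs : HasFDerivAt (Prod.snd : ℝ × E → E) (ContinuousLinearMap.snd ℝ ℝ E) z :=
    hasFDerivAt_snd
  set P : E → E := fun y => α y • grad q α y with hP
  have dP : DifferentiableAt ℝ P z.2 := dα.fun_smul dg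
  have h1 : (fun y => christoffelCLM (staticMetric q α) y (c, 0) (c, 0))
      =ᶠ[𝓝 z] fun y => ((0 : ℝ), (c ^ 2) • P y.2) := by
    filter_upwards [hG.isOpen.mem_nhds hz'] with y hy
    rw [christoffelCLM_staticMetric hq hα hαpos hy.2]
    simp [hP, smul_smul]
    ring_nf
  have h1' : ∀ u : ℝ × E, fderiv ℝ (fun y => christoffelCLM (staticMetric q α) y (c, 0) (c, 0)) z u
      = ((0 : ℝ), (c ^ 2) • fderiv ℝ P z.2 u.2) := fun u => by
    have h : HasFDerivAt (fun y : ℝ × E => ((0 : ℝ), (c ^ 2) • P y.2)) _ z :=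
      (hasFDerivAt_const (0 : ℝ) z).prodMk ((dP.hasFDerivAt.comp z hs).const_smul (c ^ 2))
    rw [h1.fderiv_eq, h.fderiv]
    simp
  -- The symbols depend on the spatial point only, so their derivative along a purely temporal
  -- vector vanishes.
  have h2 : ∀ u : ℝ × E,
      fderiv ℝ (fun y => christoffelCLM (staticMetric q α) y u (c, 0)) z (c, 0) = 0 := fun u => by
    have he : (fun y => christoffelCLM (staticMetric q α) y u (c, 0))
        =ᶠ[𝓝 z] (fun y : E => (c * fderiv ℝ α y u.2 * (α y)⁻¹, (u.1 * c) • P y)) ∘ Prod.snd := by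
      filter_upwards [hG.isOpen.mem_nhds hz'] with y hy
      rw [christoffelCLM_staticMetric hq hα hαpos hy.2]
      simp [hP, smul_smul, div_eq_mul_inv]
    have hdα : DifferentiableAt ℝ (fderiv ℝ α) z.2 :=
      hq.differentiableAt_of hz (hα.fderiv_of_isOpen (m := ∞) hq.isOpen (by simp))
    have hd : DifferentiableAt ℝ
        (fun y : E => (c * fderiv ℝ α y u.2 * (α y)⁻¹, (u.1 * c) • P y)) z.2 :=
      (((hdα.clm_apply (differentiableAt_const _)).const_mul c).fun_mul
        ((hasDerivAt_inv hα0.ne').comp_hasFDerivAt z.2 dα.hasFDerivAt).differentiableAt).prodMk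
        (dP.const_smul (u.1 * c))
    rw [he.fderiv_eq, (hd.hasFDerivAt.comp z hs).fderiv]
    simp
  -- The spatial block is `c² (D(α grad α) - dα ⊗ grad α)`. Its trace is `c² α Δα`, since the two
  -- copies of `|D α|²` cancel; the time block is zero.
  have hL : ∀ u : ℝ × E, riemann (staticMetric q α) z u (c, 0) (c, 0)
      = (0 * u.1, ((c ^ 2) • (covDerivCLM q P z.2
        - (fderiv ℝ α z.2).smulRight (grad q α z.2))) u.2) := fun u => by
    rw [riemann_eq hG hz', fderiv_christoffelCLM_apply hG hz', fderiv_christoffelCLM_apply hG hz',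
      h1', h2]
    simp only [christoffelCLM_staticMetric hq hα hαpos hz, covDerivCLM_apply, hP, smul_apply,
      sub_apply, ContinuousLinearMap.smulRight_apply]
    refine Prod.ext ?_ ?_
    · simp
      field_simp
      ring
    · simp
      match_scalars <;> field_simp
  rw [ricci_eq_trace _ _ _ (fun u => (riemannCLM_apply hG hz' u _ _).symm),
    traceCLM_prod _ _ _ (fun u => by rw [riemannCLM_apply hG hz', hL])]
  rw [map_smul, map_sub, trace_covDerivCLM_smul dα dg, traceCLM_smulRight, laplacian, smul_eq_mul]
  ring

/-- The space-space components of the Ricci tensor of a static metric. -/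
theorem ricci_staticMetric_space {z : ℝ × E} (hz : z.2 ∈ Ω) (w : E) :
    ricci (staticMetric q α) z (0, w) (0, w)
      = ricci q z.2 w w - hess q α z.2 w w / α z.2 := by
  have hG := isMetricOn_staticMetric hq hα hαpos
  have hz' : z ∈ univ ×ˢ Ω := ⟨mem_univ _, hz⟩
  have hα0 := hαpos _ hz
  have dα := hq.differentiableAt_of hz hα
  have hdα : DifferentiableAt ℝ (fderiv ℝ α) z.2 :=
    hq.differentiableAt_of hz (hα.fderiv_of_isOpen (m := ∞) hq.isOpen (by simp))
  have hs : HasFDerivAt (Prod.snd : ℝ × E → E) (ContinuousLinearMap.snd ℝ ℝ E) z :=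
    hasFDerivAt_snd
  have hC := hq.differentiableAt_of hz (contDiffOn_christoffelCLM hq)
  have dC : ∀ a b, DifferentiableAt ℝ (fun y => christoffelCLM q y a b) z.2 := fun a b =>
    (hC.clm_apply (differentiableAt_const a)).clm_apply (differentiableAt_const b)
  have h1 : ∀ u v : ℝ × E, fderiv ℝ (fun y => christoffelCLM (staticMetric q α) y u (0, w)) z v
      = (u.1 * (fderiv ℝ (fderiv ℝ α) z.2 v.2 w / α z.2
          - fderiv ℝ α z.2 w * fderiv ℝ α z.2 v.2 / α z.2 ^ 2),
        fderiv ℝ (fun y => christoffelCLM q y u.2 w) z.2 v.2) := fun u v => by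
    have he : (fun y => christoffelCLM (staticMetric q α) y u (0, w)) =ᶠ[𝓝 z]
        (fun y : E => (u.1 * (fderiv ℝ α y w * (α y)⁻¹), christoffelCLM q y u.2 w))
          ∘ Prod.snd := by
      filter_upwards [hG.isOpen.mem_nhds hz'] with y hy
      rw [christoffelCLM_staticMetric hq hα hαpos hy.2]
      simp [div_eq_mul_inv, mul_assoc]
    have hi : HasFDerivAt (fun y => (α y)⁻¹) _ z.2 :=
      (hasDerivAt_inv hα0.ne').comp_hasFDerivAt z.2 dα.hasFDerivAt
    have hd : HasFDerivAt
        (fun y : E => (u.1 * (fderiv ℝ α y w * (α y)⁻¹), christoffelCLM q y u.2 w)) _ z.2 :=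
      (((hdα.hasFDerivAt.clm_apply (hasFDerivAt_const w z.2)).fun_mul hi).const_mul u.1).prodMk
        (dC u.2 w).hasFDerivAt
    rw [he.fderiv_eq, (hd.comp z hs).fderiv]
    refine Prod.ext ?_ ?_
    · simp
      field_simp
      ring
    · simp
  -- The spatial block is the curvature operator of `q`; the time block is the scalar `-Hess α(w, w)
  -- / α`.
  have hL : ∀ u : ℝ × E, riemann (staticMetric q α) z u (0, w) (0, w)
      = (-(hess q α z.2 w w / α z.2) * u.1, riemannCLM q z.2 w w u.2) := fun u => by
    rw [riemann_eq hG hz', fderiv_christoffelCLM_apply hG hz', fderiv_christoffelCLM_apply hG hz',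
      h1, h1, riemannCLM_apply hq hz, riemann_eq hq hz, fderiv_christoffelCLM_apply hq hz,
      fderiv_christoffelCLM_apply hq hz, hess]
    simp only [christoffelCLM_staticMetric hq hα hαpos hz]
    refine Prod.ext ?_ ?_
    · simp
      field_simp
      ring
    · simp
  rw [ricci_eq_trace _ _ _ (fun u => (riemannCLM_apply hG hz' u _ _).symm),
    traceCLM_prod _ _ _ (fun u => by rw [riemannCLM_apply hG hz', hL]),
    ricci_eq_trace w w _ (fun u => (riemannCLM_apply hq hz u _ _).symm)]
  ring

end StaticMetric

/-! ### Null geodesics and the second derivative of `f` along them. -/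

section Geodesics

/-- Existence of geodesics in coordinates. -/
theorem exists_geodesic {F : Type*} [NormedAddCommGroup F] [NormedSpace ℝ F]
    [FiniteDimensional ℝ F] {g : F → F →L[ℝ] F →L[ℝ] ℝ} {Ω : Set F} (hg : IsMetricOn g Ω)
    {z : F} (hz : z ∈ Ω) (v : F) :
    ∃ ε > (0 : ℝ), ∃ c : ℝ → F, c 0 = z ∧ deriv c 0 = v ∧ ∀ s ∈ Ioo (-ε) ε, c s ∈ Ω ∧
      DifferentiableAt ℝ c s ∧
      HasDerivAt (deriv c) (-christoffel g (c s) (deriv c s) (deriv c s)) s := by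
  have hC := (contDiffOn_christoffelCLM hg).contDiffAt (hg.isOpen.mem_nhds hz)
  -- The geodesic equation as a first-order system in position and velocity, to which
  -- Picard–Lindelöf applies.
  let f : F × F → F × F := fun p => (p.2, -christoffelCLM g p.1 p.2 p.2)
  have hf : ContDiffAt ℝ 1 f (z, v) := by
    have h1 : ContDiffAt ℝ ∞ (fun p : F × F => christoffelCLM g p.1) (z, v) :=
      ContDiffAt.comp (g := christoffelCLM g) (z, v) hC contDiffAt_fst
    exact (contDiffAt_snd.prodMk ((h1.clm_apply contDiffAt_snd).clm_apply contDiffAt_snd).neg).of_le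
      (by norm_cast)
  obtain ⟨γ, h0, ε, hε, hγ⟩ :=
    hf.exists_forall_mem_closedBall_exists_eq_forall_mem_Ioo_hasDerivAt₀ 0
  have hcont : ContinuousAt (fun s => (γ s).1) 0 :=
    continuousAt_fst.comp (hγ 0 (by simp [hε])).continuousAt
  have hΩ : ∀ᶠ s in 𝓝 (0 : ℝ), (γ s).1 ∈ Ω :=
    hcont.eventually (hg.isOpen.mem_nhds (by simpa [h0] using hz))
  obtain ⟨δ, hδ, hδΩ⟩ := Metric.eventually_nhds_iff.1 hΩ
  have hγ1 : ∀ s ∈ Ioo (-ε) ε, HasDerivAt (fun s => (γ s).1) (γ s).2 s := fun s hs =>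
    (hγ s (by simpa using hs)).fst
  have hd : ∀ s ∈ Ioo (-ε) ε, deriv (fun s => (γ s).1) =ᶠ[𝓝 s] fun s => (γ s).2 := fun s hs => by
    filter_upwards [isOpen_Ioo.mem_nhds hs] with t ht using (hγ1 t ht).deriv
  -- `ε` bounds the existence time of the solution, and `δ` keeps its position inside `Ω`.
  refine ⟨min ε δ, lt_min hε hδ, fun s => (γ s).1, by simp [h0], ?_, fun s hs => ?_⟩
  · rw [(hγ1 0 (by simp [hε])).deriv, h0]
  · have hs1 : s ∈ Ioo (-ε) ε :=
      ⟨(neg_le_neg (min_le_left _ _)).trans_lt hs.1, hs.2.trans_le (min_le_left _ _)⟩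
    have hs2 : (γ s).1 ∈ Ω := hδΩ (by
      rw [Real.dist_eq, sub_zero, abs_lt]
      exact ⟨(neg_le_neg (min_le_right _ _)).trans_lt hs.1, hs.2.trans_le (min_le_right _ _)⟩)
    refine ⟨hs2, (hγ1 s hs1).differentiableAt, ?_⟩
    rw [(hγ1 s hs1).deriv, ← christoffelCLM_apply hg hs2]
    have h2 : HasDerivAt (fun s => (γ s).2) (-christoffelCLM g (γ s).1 (γ s).2 (γ s).2) s :=
      (hγ s (by simpa using hs1)).snd
    exact h2.congr_of_eventuallyEq (hd s hs1)

/-- The slope of `F'` at `0` tends to `a > 0`, so `F'` is positive just to the right of `0` and `F`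
increases strictly from `0`. Only a one-point second derivative is required, which is what the
geodesic equation supplies here. -/
lemma eventually_pos_of_second_deriv_pos {F F' : ℝ → ℝ} {a : ℝ}
    (hF : ∀ᶠ s in 𝓝 (0 : ℝ), HasDerivAt F (F' s) s) (hF' : HasDerivAt F' a 0) (h0 : F 0 = 0)
    (h0' : F' 0 = 0) (ha : 0 < a) : ∀ᶠ s in 𝓝[>] (0 : ℝ), 0 < F s := by
  have h1 : ∀ᶠ s in 𝓝[>] (0 : ℝ), 0 < F' s := by
    have := (hasDerivAt_iff_tendsto_slope.1 hF').eventually (lt_mem_nhds ha)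
    have hle : 𝓝[>] (0 : ℝ) ≤ 𝓝[≠] 0 := nhdsWithin_mono _ fun s hs => ne_of_gt hs
    filter_upwards [hle this, self_mem_nhdsWithin] with s hs hs0
    rw [slope_def_field, h0', sub_zero, sub_zero] at hs
    exact (div_pos_iff_of_pos_right hs0).1 hs
  obtain ⟨δ, hδ, hFδ⟩ := Metric.eventually_nhds_iff.1 hF
  obtain ⟨η, hη, hFη⟩ := mem_nhdsGT_iff_exists_Ioo_subset.1 h1
  have hm : 0 < min δ η := lt_min hδ hη
  filter_upwards [Ioo_mem_nhdsGT hm] with s hs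
  have hmono : StrictMonoOn F (Icc 0 s) := by
    have hder : ∀ t ∈ Icc 0 s, HasDerivAt F (F' t) t := fun t ht => hFδ (by
      rw [Real.dist_eq, sub_zero, abs_of_nonneg ht.1]
      exact ht.2.trans_lt (hs.2.trans_le (min_le_left _ _)))
    refine strictMonoOn_of_deriv_pos (convex_Icc 0 s)
      (fun t ht => (hder t ht).continuousAt.continuousWithinAt) fun t ht => ?_
    rw [interior_Icc] at ht
    rw [(hder t (Ioo_subset_Icc_self ht)).deriv]
    exact hFη ⟨ht.1, ht.2.trans (hs.2.trans_le (min_le_right _ _))⟩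
  have := hmono (left_mem_Icc.2 hs.1.le) (right_mem_Icc.2 hs.1.le) hs.1
  rwa [h0] at this

variable {E : Type*} [NormedAddCommGroup E] [NormedSpace ℝ E] [FiniteDimensional ℝ E]
variable {q : E → E →L[ℝ] E →L[ℝ] ℝ} {f α : E → ℝ} {Ω : Set E}

/-- If a tangential null geodesic does not leave the inside `{f ≤ 0}`, then the second derivative
of `f` along it is not positive. -/
theorem hess_le_of_geodesic (hq : IsMetricOn q Ω) (hα : ContDiffOn ℝ ∞ α Ω)
    (hαpos : ∀ y ∈ Ω, 0 < α y) (hf : ContDiffOn ℝ ∞ f Ω) {c : ℝ → ℝ × E} {ε : ℝ} (hε : 0 < ε)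
    (hc : ∀ s ∈ Ioo (-ε) ε, c s ∈ univ ×ˢ Ω ∧ DifferentiableAt ℝ c s ∧
      HasDerivAt (deriv c)
        (-christoffel (staticMetric q α) (c s) (deriv c s) (deriv c s)) s)
    (h0 : f (c 0).2 = 0) (hu : fderiv ℝ f (c 0).2 (deriv c 0).2 = 0)
    (hnull : α (c 0).2 ^ 2 * (deriv c 0).1 ^ 2 = q (c 0).2 (deriv c 0).2 (deriv c 0).2)
    (hle : ∀ᶠ s in 𝓝[>] (0 : ℝ), f (c s).2 ≤ 0) :
    hess q f (c 0).2 (deriv c 0).2 (deriv c 0).2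
      ≤ fderiv ℝ f (c 0).2 (grad q α (c 0).2) / α (c 0).2
        * q (c 0).2 (deriv c 0).2 (deriv c 0).2 := by
  have hI : Ioo (-ε) ε ∈ 𝓝 (0 : ℝ) := isOpen_Ioo.mem_nhds (by simp [hε])
  obtain ⟨hz, hd, hdd⟩ := hc 0 (by simp [hε])
  have hx := hz.2
  have hα0 := hαpos _ hx
  rw [← christoffelCLM_apply (isMetricOn_staticMetric hq hα hαpos) hz,
    christoffelCLM_staticMetric hq hα hαpos hx] at hdd
  have hdf : DifferentiableAt ℝ (fderiv ℝ f) (c 0).2 :=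
    hq.differentiableAt_of hx (hf.fderiv_of_isOpen (m := ∞) hq.isOpen (by simp))
  have h1 : ∀ᶠ s in 𝓝 (0 : ℝ),
      HasDerivAt (fun s => f (c s).2) (fderiv ℝ f (c s).2 (deriv c s).2) s := by
    filter_upwards [hI] with s hs
    obtain ⟨hzs, hds, -⟩ := hc s hs
    exact (hq.differentiableAt_of hzs.2 hf).hasFDerivAt.comp_hasDerivAt s hds.hasDerivAt.snd
  have h2 : HasDerivAt (fun s => fderiv ℝ f (c s).2) _ 0 :=
    hdf.hasFDerivAt.comp_hasDerivAt 0 hd.hasDerivAt.snd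
  have h3 := h2.clm_apply hdd.snd
  by_contra hcon
  have hpos : 0 < fderiv ℝ (fderiv ℝ f) (c 0).2 (deriv c 0).2 (deriv c 0).2
      + fderiv ℝ f (c 0).2 (-(christoffelCLM q (c 0).2 (deriv c 0).2 (deriv c 0).2
        + ((deriv c 0).1 * (deriv c 0).1 * α (c 0).2) • grad q α (c 0).2)) := by
    -- Nullity replaces `|u|²` by `α² τ²`, so the right-hand side becomes the contribution of the
    -- time component of the velocity to the spatial acceleration.
    rw [not_le, hess, ← hnull] at hcon
    have h4 : fderiv ℝ f (c 0).2 (grad q α (c 0).2) / α (c 0).2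
        * (α (c 0).2 ^ 2 * (deriv c 0).1 ^ 2)
        = (deriv c 0).1 * (deriv c 0).1 * α (c 0).2 * fderiv ℝ f (c 0).2 (grad q α (c 0).2) := by
      field_simp
    rw [h4] at hcon
    simp only [map_neg, map_add, map_smul, smul_eq_mul]
    linarith
  have h5 := eventually_pos_of_second_deriv_pos h1 h3 h0 hu hpos
  obtain ⟨s, hs, hs'⟩ := (hle.and h5).exists
  exact absurd hs' (not_lt.2 hs)

end Geodesics

end CoordGeom

/-! ### Smoothness and derivatives in charts of the slice. -/

section ChartDerivative

variable {E : Type*} [NormedAddCommGroup E] [NormedSpace ℝ E] [FiniteDimensional ℝ E]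
  {X : Type*} [TopologicalSpace X] [ChartedSpace E X] [IsManifold 𝓘(ℝ, E) ∞ X]
  {e : OpenPartialHomeomorph X E} (he : e ∈ IsManifold.maximalAtlas 𝓘(ℝ, E) ∞ X)

/-- The derivative of the inverse of a chart. -/
def chartDeriv (e : OpenPartialHomeomorph X E) (y : E) :
    E →L[ℝ] E :=
  mfderiv 𝓘(ℝ, E) 𝓘(ℝ, E) (e.extend 𝓘(ℝ, E)).symm y

include he

lemma contMDiffOn_extend_symm_target :
    ContMDiffOn 𝓘(ℝ, E) 𝓘(ℝ, E) ∞ (e.extend 𝓘(ℝ, E)).symm e.target := by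
  simpa using contMDiffOn_extend_symm he

lemma contMDiffAt_extend_symm_target {y : E} (hy : y ∈ e.target) :
    ContMDiffAt 𝓘(ℝ, E) 𝓘(ℝ, E) ∞ (e.extend 𝓘(ℝ, E)).symm y :=
  (contMDiffOn_extend_symm_target he).contMDiffAt (e.open_target.mem_nhds hy)

lemma mdifferentiableAt_extend_symm {y : E} (hy : y ∈ e.target) :
    MDifferentiableAt 𝓘(ℝ, E) 𝓘(ℝ, E) (e.extend 𝓘(ℝ, E)).symm y :=
  (contMDiffAt_extend_symm_target he hy).mdifferentiableAt (by simp)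

omit he [FiniteDimensional ℝ E] [IsManifold 𝓘(ℝ, E) ∞ X] in
lemma extend_symm_mem_source {y : E} (hy : y ∈ e.target) :
    (e.extend 𝓘(ℝ, E)).symm y ∈ e.source := by
  simpa using e.map_target hy

omit he [FiniteDimensional ℝ E] [IsManifold 𝓘(ℝ, E) ∞ X] in
lemma extend_extend_symm {y : E} (hy : y ∈ e.target) :
    e.extend 𝓘(ℝ, E) ((e.extend 𝓘(ℝ, E)).symm y) = y := by
  simp [hy]

lemma bijective_chartDeriv {y : E} (hy : y ∈ e.target) : Function.Bijective (chartDeriv e y) := by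
  have h1 := mdifferentiableAt_extend_symm he hy
  have hinj : Function.Injective (chartDeriv e y) := by
    have h2 : MDifferentiableAt 𝓘(ℝ, E) 𝓘(ℝ, E) (e.extend 𝓘(ℝ, E))
        ((e.extend 𝓘(ℝ, E)).symm y) :=
      (e.contMDiffAt_extend he (extend_symm_mem_source hy)).mdifferentiableAt (by simp)
    have h3 : (e.extend 𝓘(ℝ, E)) ∘ (e.extend 𝓘(ℝ, E)).symm =ᶠ[𝓝 y] id := by
      filter_upwards [e.open_target.mem_nhds hy] with z hz using extend_extend_symm hz
    have h4 := mfderiv_comp y h2 h1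
    rw [h3.mfderiv_eq, mfderiv_id] at h4
    intro u v huv
    have hu := DFunLike.congr_fun h4 u
    have hv := DFunLike.congr_fun h4 v
    have : (mfderiv 𝓘(ℝ, E) 𝓘(ℝ, E) (e.extend 𝓘(ℝ, E)) ((e.extend 𝓘(ℝ, E)).symm y))
        (chartDeriv e y u) = (mfderiv 𝓘(ℝ, E) 𝓘(ℝ, E) (e.extend 𝓘(ℝ, E))
        ((e.extend 𝓘(ℝ, E)).symm y)) (chartDeriv e y v) := by rw [huv]
    exact hu.trans (this.trans hv.symm)
  let L : E →ₗ[ℝ] E := (chartDeriv e y).toLinearMap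
  exact ⟨hinj, (LinearMap.injective_iff_surjective (f := L)).1 hinj⟩

lemma fderiv_comp_extend_symm {h : X → ℝ} {y : E} (hy : y ∈ e.target)
    (hh : MDifferentiableAt 𝓘(ℝ, E) 𝓘(ℝ, ℝ) h ((e.extend 𝓘(ℝ, E)).symm y)) (u : E) :
    fderiv ℝ (h ∘ (e.extend 𝓘(ℝ, E)).symm) y u
      = (mfderiv 𝓘(ℝ, E) 𝓘(ℝ, ℝ) h ((e.extend 𝓘(ℝ, E)).symm y) (chartDeriv e y u) : ℝ) := by
  have h1 := mfderiv_comp y hh (mdifferentiableAt_extend_symm he hy)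
  rw [mfderiv_eq_fderiv] at h1
  exact DFunLike.congr_fun h1 u

lemma contDiffOn_comp_extend_symm {h : X → ℝ} {s : Set X}
    (hh : ContMDiffOn 𝓘(ℝ, E) 𝓘(ℝ, ℝ) ∞ h s) :
    ContDiffOn ℝ ∞ (h ∘ (e.extend 𝓘(ℝ, E)).symm)
      (e.target ∩ (e.extend 𝓘(ℝ, E)).symm ⁻¹' s) := by
  rw [← contMDiffOn_iff_contDiffOn]
  exact hh.comp ((contMDiffOn_extend_symm_target he).mono inter_subset_left) inter_subset_right

lemma contMDiffAt_of_contDiffAt {h : X → ℝ} {p : X} (hp : p ∈ e.source)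
    (hh : ContDiffAt ℝ ∞ (h ∘ (e.extend 𝓘(ℝ, E)).symm) (e.extend 𝓘(ℝ, E) p)) :
    ContMDiffAt 𝓘(ℝ, E) 𝓘(ℝ, ℝ) ∞ h p := by
  have h1 := (contMDiffAt_iff_contDiffAt.2 hh).comp p (e.contMDiffAt_extend he hp)
  refine h1.congr_of_eventuallyEq ?_
  filter_upwards [e.open_source.mem_nhds hp] with x hx
  simp [hx]

/-- The chart's coordinate vector fields are smooth sections along the inverse chart, being its
tangent map on constant vectors; evaluating the smooth form on two of them gives smooth
coefficients. -/
lemma contDiffOn_localForm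
    (g : ∀ x : X, TangentSpace 𝓘(ℝ, E) x →L[ℝ] TangentSpace 𝓘(ℝ, E) x →L[ℝ] ℝ)
    (hg : ContMDiff 𝓘(ℝ, E) (𝓘(ℝ, E).prod 𝓘(ℝ, E →L[ℝ] E →L[ℝ] ℝ)) ∞
      (fun x => Bundle.TotalSpace.mk' (E →L[ℝ] E →L[ℝ] ℝ)
        (E := fun x : X => TangentSpace 𝓘(ℝ, E) x →L[ℝ] TangentSpace 𝓘(ℝ, E) x →L[ℝ] ℝ)
        x (g x))) :
    ContDiffOn ℝ ∞ (localForm 𝓘(ℝ, E) g e) e.target := by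
  have hψ := contMDiffOn_extend_symm_target he
  have hA : ∀ u : E, ContMDiffOn 𝓘(ℝ, E) (𝓘(ℝ, E).prod 𝓘(ℝ, E)) ∞
      (fun y => Bundle.TotalSpace.mk' E (E := fun x : X => TangentSpace 𝓘(ℝ, E) x)
        ((e.extend 𝓘(ℝ, E)).symm y) (chartDeriv e y u)) e.target := fun u => by
    have h1 : ContMDiffOn 𝓘(ℝ, E) 𝓘(ℝ, E).tangent ∞
        (fun y : E => (⟨y, u⟩ : TangentBundle 𝓘(ℝ, E) E)) e.target :=
      contMDiffOn_vectorSpace_iff_contDiffOn.2 contDiffOn_const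
    have h2 := hψ.contMDiffOn_tangentMapWithin (m := ∞) (by simp)
      e.open_target.uniqueMDiffOn
    have h3 := h2.comp h1 (fun y hy => hy)
    refine h3.congr fun y hy => ?_
    simp only [Function.comp_apply, tangentMapWithin, mfderivWithin_of_isOpen e.open_target hy]
    rfl
  rw [contDiffOn_clm_apply]
  intro u
  rw [contDiffOn_clm_apply]
  intro v
  have hb : ContMDiffOn 𝓘(ℝ, E) (𝓘(ℝ, E).prod 𝓘(ℝ, ℝ)) ∞
      (fun y => Bundle.TotalSpace.mk' ℝ (E := Bundle.Trivial X ℝ) ((e.extend 𝓘(ℝ, E)).symm y)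
        (g ((e.extend 𝓘(ℝ, E)).symm y) (chartDeriv e y u) (chartDeriv e y v))) e.target :=
    ContMDiffOn.clm_bundle_apply₂ (F₁ := E) (F₂ := E) (hg.comp_contMDiffOn hψ) (hA u) (hA v)
  rw [← contMDiffOn_iff_contDiffOn]
  intro y hy
  have := hb y hy
  simp only [Bundle.contMDiffWithinAt_totalSpace] at this
  exact this.2

end ChartDerivative

/-! ### Product charts of the spacetime. -/

section ProductChart

variable {X : Type*} [TopologicalSpace X] [ChartedSpace E3 X] [IsManifold 𝓘(ℝ, E3) ∞ X]
  {e : OpenPartialHomeomorph X E3}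

/-- The chart of `ℝ × X` given by a chart of `X`. -/
def productChart (e : OpenPartialHomeomorph X E3) :
    OpenPartialHomeomorph (ℝ × X) (ModelProd ℝ E3) :=
  (OpenPartialHomeomorph.refl ℝ).prod e

lemma productChart_mem (he : e ∈ IsManifold.maximalAtlas 𝓘(ℝ, E3) ∞ X) :
    productChart e ∈ IsManifold.maximalAtlas I4 ∞ (ℝ × X) :=
  IsManifold.mem_maximalAtlas_prod (StructureGroupoid.id_mem_maximalAtlas _) he

lemma productChart_extend (p : ℝ × X) :
    (productChart e).extend I4 p = (p.1, e.extend 𝓘(ℝ, E3) p.2) := rfl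

lemma productChart_extend_symm (z : ℝ × E3) :
    ((productChart e).extend I4).symm z = (z.1, (e.extend 𝓘(ℝ, E3)).symm z.2) := rfl

lemma mem_productChart_source (p : ℝ × X) : p ∈ (productChart e).source ↔ p.2 ∈ e.source := by
  simp [productChart]

lemma hasMFDerivAt_productChart_symm (he : e ∈ IsManifold.maximalAtlas 𝓘(ℝ, E3) ∞ X)
    {z : ℝ × E3} (hz : z.2 ∈ e.target) :
    HasMFDerivAt 𝓘(ℝ, ℝ × E3) I4 ((productChart e).extend I4).symm z
      ((ContinuousLinearMap.fst ℝ ℝ E3).prod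
        (chartDeriv e z.2 ∘L ContinuousLinearMap.snd ℝ ℝ E3)) := by
  have h1 : HasMFDerivAt 𝓘(ℝ, ℝ × E3) 𝓘(ℝ, ℝ) (Prod.fst : ℝ × E3 → ℝ) z
      (ContinuousLinearMap.fst ℝ ℝ E3) := hasFDerivAt_fst.hasMFDerivAt
  have h2 : HasMFDerivAt 𝓘(ℝ, ℝ × E3) 𝓘(ℝ, E3) (Prod.snd : ℝ × E3 → E3) z
      (ContinuousLinearMap.snd ℝ ℝ E3) := hasFDerivAt_snd.hasMFDerivAt
  have h3 := (mdifferentiableAt_extend_symm he hz).hasMFDerivAt.comp z h2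
  exact h1.prodMk h3

lemma localForm_productChart_apply (he : e ∈ IsManifold.maximalAtlas 𝓘(ℝ, E3) ∞ X)
    (T : ∀ x : ℝ × X, TangentSpace I4 x →L[ℝ] TangentSpace I4 x →L[ℝ] ℝ)
    {z : ℝ × E3} (hz : z.2 ∈ e.target) (u v : ℝ × E3) :
    localForm I4 T (productChart e) z u v
      = T (z.1, (e.extend 𝓘(ℝ, E3)).symm z.2)
        (spacetimeVector (z.1, (e.extend 𝓘(ℝ, E3)).symm z.2) u.1 (chartDeriv e z.2 u.2))
        (spacetimeVector (z.1, (e.extend 𝓘(ℝ, E3)).symm z.2) v.1 (chartDeriv e z.2 v.2)) := by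
  have h := (hasMFDerivAt_productChart_symm he hz).mfderiv
  simp only [localForm]
  rw [h]
  rfl

/-- In a product chart, the metric of a static spacetime is static. -/
lemma localForm_metric_productChart (W : StaticSpacetime X)
    (he : e ∈ IsManifold.maximalAtlas 𝓘(ℝ, E3) ∞ X) {z : ℝ × E3} (hz : z.2 ∈ e.target) :
    localForm I4 W.metric (productChart e) z
      = CoordGeom.staticMetric (W.localMetric e) (localFun W.α e) z := by
  refine ContinuousLinearMap.ext fun u => ContinuousLinearMap.ext fun v => ?_
  rw [localForm_productChart_apply he W.metric hz, CoordGeom.staticMetric_apply]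
  rfl

end ProductChart

namespace CoordGeom

/-! ### Christoffel symbols and Ricci tensor depend only on the germ of the metric. -/

section Congr

variable {E : Type*} [NormedAddCommGroup E] [NormedSpace ℝ E] {g g' : E → E →L[ℝ] E →L[ℝ] ℝ}
  {x : E}

/-- Needed because the coordinate metric of the spacetime is identified with a static metric on the
chart's domain only. -/
lemma christoffel_congr (h : g =ᶠ[𝓝 x] g') : christoffel g x = christoffel g' x := by
  have h1 : ∀ v, fderiv ℝ (fun y => g y v) x = fderiv ℝ (fun y => g' y v) x := fun v => by
    have h0 : (fun y => g y v) =ᶠ[𝓝 x] fun y => g' y v := h.mono fun y hy => by simp only [hy]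
    exact h0.fderiv_eq
  have h2 : ∀ u v, fderiv ℝ (fun y => g y u v) x = fderiv ℝ (fun y => g' y u v) x := fun u v => by
    have h0 : (fun y => g y u v) =ᶠ[𝓝 x] fun y => g' y u v := h.mono fun y hy => by simp only [hy]
    exact h0.fderiv_eq
  ext u v
  simp only [christoffel, h.eq_of_nhds, h1, h2]

lemma ricci_congr [FiniteDimensional ℝ E] (h : g =ᶠ[𝓝 x] g') (v w : E) :
    ricci g x v w = ricci g' x v w := by
  have h1 : ∀ u v, fderiv ℝ (fun y => christoffel g y u v) x
      = fderiv ℝ (fun y => christoffel g' y u v) x := fun u v => by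
    have h0 : (fun y => christoffel g y u v) =ᶠ[𝓝 x] fun y => christoffel g' y u v :=
      h.eventuallyEq_nhds.mono fun y hy => by simp only [christoffel_congr hy]
    exact h0.fderiv_eq
  simp only [ricci, riemann, h1, christoffel_congr h]

end Congr

end CoordGeom

/-! ### The physical hypotheses translated into coordinates. -/

section Assembly

open CoordGeom

variable {X : Type*} [TopologicalSpace X] [ChartedSpace E3 X] [IsManifold 𝓘(ℝ, E3) ∞ X]
  {W : StaticSpacetime X} {S : DividingSurface X} {e : OpenPartialHomeomorph X E3}
  {y : E3} {Ω : Set E3}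

lemma localMetric_apply (W : StaticSpacetime X) (y u v : E3) :
    W.localMetric e y u v
      = W.q.inner ((e.extend 𝓘(ℝ, E3)).symm y) (chartDeriv e y u) (chartDeriv e y v) := rfl

section Chart

variable (he : e ∈ IsManifold.maximalAtlas 𝓘(ℝ, E3) ∞ X)

include he

lemma localMetric_pos (W : StaticSpacetime X) (hy : y ∈ e.target) (u : E3) (hu : u ≠ 0) :
    0 < W.localMetric e y u u := by
  rw [localMetric_apply]
  refine W.q.pos _ _ fun h => hu ((bijective_chartDeriv he hy).1 ?_)
  rw [map_zero]
  exact h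

lemma isMetricOn_localMetric (W : StaticSpacetime X) :
    IsMetricOn (W.localMetric e) e.target where
  isOpen := e.open_target
  smooth := contDiffOn_localForm he W.q.inner W.q.contMDiff
  symm _ _ _ _ := W.q.symm _ _ _
  inv _ hy := isInvertible_of_pos _ (localMetric_pos he W hy)

lemma contDiffOn_localFun {h : X → ℝ} (hh : ContMDiff 𝓘(ℝ, E3) 𝓘(ℝ, ℝ) ∞ h) :
    ContDiffOn ℝ ∞ (localFun h e) e.target := by
  have := contDiffOn_comp_extend_symm he (hh.contMDiffOn (s := univ))
  simpa [localFun] using this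

lemma fderiv_localFun {h : X → ℝ} (hh : ContMDiff 𝓘(ℝ, E3) 𝓘(ℝ, ℝ) ∞ h) (hy : y ∈ e.target)
    (u : E3) :
    fderiv ℝ (localFun h e) y u
      = (mfderiv 𝓘(ℝ, E3) 𝓘(ℝ, ℝ) h ((e.extend 𝓘(ℝ, E3)).symm y) (chartDeriv e y u) : ℝ) :=
  fderiv_comp_extend_symm he hy (hh.mdifferentiableAt (by simp)) u

/-- Absence of critical points is an open condition, so one may restrict to where it holds; `f` is
assumed regular only on the surface. -/
lemma isFoliationOn_localFun (W : StaticSpacetime X) {h : E3 → ℝ} {Ω : Set E3}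
    (hΩ : IsOpen Ω) (hsub : Ω ⊆ e.target) (hh : ContDiffOn ℝ ∞ h Ω) :
    IsFoliationOn (W.localMetric e) h (Ω ∩ {y | fderiv ℝ h y ≠ 0}) := by
  have hcont : ContinuousOn (fderiv ℝ h) Ω := hh.continuousOn_fderiv_of_isOpen hΩ (by simp)
  have hop : IsOpen (Ω ∩ {y | fderiv ℝ h y ≠ 0}) :=
    hcont.isOpen_inter_preimage hΩ isOpen_ne
  exact ⟨(isMetricOn_localMetric he W).mono hop (inter_subset_left.trans hsub),
    fun y hy => localMetric_pos he W (hsub hy.1), hh.mono inter_subset_left, fun y hy => hy.2⟩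

/-- The coordinate expression of the outward unit normal. -/
lemma isOutwardUnitNormal_unitNormal (H : IsFoliationOn (W.localMetric e) (localFun S.f e) Ω)
    (hsub : Ω ⊆ e.target) (hy : y ∈ Ω) :
    IsOutwardUnitNormal W S ((e.extend 𝓘(ℝ, E3)).symm y)
      (chartDeriv e y (unitNormal (W.localMetric e) (localFun S.f e) y)) := by
  refine ⟨H.metric_unitNormal_self hy, fun u hu => ?_, ?_⟩
  · obtain ⟨u', rfl⟩ := (bijective_chartDeriv he (hsub hy)).2 u
    have h1 := H.fderiv_eq_metric hy u'
    rw [fderiv_localFun he S.smooth_f (hsub hy)] at h1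
    have h2 := h1.symm.trans hu
    exact (mul_eq_zero.1 h2).resolve_left (H.sqrt_gradSq_pos hy).ne'
  · have h1 := H.fderiv_unitNormal hy
    rw [fderiv_localFun he S.smooth_f (hsub hy)] at h1
    exact h1 ▸ H.sqrt_gradSq_pos hy

/-- The Einstein equations and `ρ + P_r = 0` determine `Ric(r̂, r̂)`. -/
lemma ricci_unitNormal {G : ℝ}
    {T : ∀ x : ℝ × X, TangentSpace I4 x →L[ℝ] TangentSpace I4 x →L[ℝ] ℝ}
    (hT : EinsteinEquations I4 G W.metric T) (hρP : EnergyPlusRadialPressureVanishes W S T)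
    (H : IsFoliationOn (W.localMetric e) (localFun S.f e) Ω)
    (hsub : Ω ⊆ e.target) (hy : y ∈ Ω) (h0 : localFun S.f e y = 0) :
    localFun W.α e y * ricci (W.localMetric e) y
        (unitNormal (W.localMetric e) (localFun S.f e) y)
        (unitNormal (W.localMetric e) (localFun S.f e) y)
      = hess (W.localMetric e) (localFun W.α e) y
          (unitNormal (W.localMetric e) (localFun S.f e) y)
          (unitNormal (W.localMetric e) (localFun S.f e) y)
        - laplacian (W.localMetric e) (localFun W.α e) y := by
  set q := W.localMetric e with hq
  set α := localFun W.α e with hα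
  set N := unitNormal q (localFun S.f e) y with hN
  have hyt := hsub hy
  have hM : IsMetricOn q e.target := isMetricOn_localMetric he W
  have hαs : ContDiffOn ℝ ∞ α e.target := contDiffOn_localFun he W.smooth_α
  have hαp : ∀ y ∈ e.target, 0 < α y := fun y _ => W.α_pos _
  have hα0 := hαp y hyt
  let z : ℝ × E3 := (0, y)
  have hz : z.2 ∈ e.target := hyt
  have hg : localForm I4 W.metric (productChart e) =ᶠ[𝓝 z] staticMetric q α := by
    have hop : IsOpen ((univ : Set ℝ) ×ˢ e.target) := isOpen_univ.prod e.open_target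
    filter_upwards [hop.mem_nhds (show z ∈ (univ : Set ℝ) ×ˢ e.target from ⟨mem_univ _, hz⟩)]
      with w hw using localForm_metric_productChart W he hw.2
  have hsrc : ((productChart e).extend I4).symm z ∈ (productChart e).source := by
    rw [mem_productChart_source, productChart_extend_symm]
    exact extend_symm_mem_source hz
  have hzz : (productChart e).extend I4 (((productChart e).extend I4).symm z) = z := by
    rw [productChart_extend, productChart_extend_symm, extend_extend_symm hz]
  have hE := fun u => hT (productChart e) (productChart_mem he) _ hsrc u u
  simp only [hzz, hg.eq_of_nhds, ricci_congr hg] at hE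
  -- The Einstein equations are evaluated on `n = α⁻¹ ∂_t` and then on the unit normal.
  have h1 := hE ((α y)⁻¹, 0)
  have h2 := hE (0, N)
  rw [ricci_staticMetric_time hM hαs hαp hz, localForm_productChart_apply he T hz,
    staticMetric_apply] at h1
  rw [ricci_staticMetric_space hM hαs hαp hz, localForm_productChart_apply he T hz,
    staticMetric_apply] at h2
  have h3 := hρP (z.1, (e.extend 𝓘(ℝ, E3)).symm z.2) h0 _
    (isOutwardUnitNormal_unitNormal he H hsub hy)
  have hNN : q y N N = 1 := H.metric_unitNormal_self hy
  simp only [map_zero] at h1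
  have h4 : ∀ a b c : ℝ, a + b = 0 → c * a + c * b = 0 := fun a b c h => by
    rw [← mul_add, h, mul_zero]
  have h5 := h4 _ _ (8 * Real.pi * G) h3
  -- In the sum the scalar curvature drops out, as `g(n, n) = -1` and `g(N, N) = 1`; the right-hand
  -- side is `8 π G (ρ + P_r) = 0`.
  have h6 := congrArg₂ (· + ·) h1 h2
  have h7 := h6.trans h5
  simp only [z, hNN] at h7
  field_simp at h7
  linarith

/-- The trapping condition in coordinates: `D_u D_u f ≤ |u|² ⟨D f, D α⟩ / α` for vectors `u`
tangent to the surface. -/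
lemma hess_le_of_isTTS (hTTS : IsTTS W S) (hy : y ∈ e.target) (h0 : localFun S.f e y = 0)
    (u : E3) (hu : fderiv ℝ (localFun S.f e) y u = 0) :
    hess (W.localMetric e) (localFun S.f e) y u u
      ≤ fderiv ℝ (localFun S.f e) y (grad (W.localMetric e) (localFun W.α e) y)
        / localFun W.α e y * W.localMetric e y u u := by
  -- For `u = 0` both sides vanish; this case is separate because a null vector with zero spatial
  -- part has `τ = 0` and is not future-directed.
  by_cases hu0 : u = 0
  · simp [hu0, hess]
  set q := W.localMetric e with hq
  set α := localFun W.α e with hα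
  have hM : IsMetricOn q e.target := isMetricOn_localMetric he W
  have hαs : ContDiffOn ℝ ∞ α e.target := contDiffOn_localFun he W.smooth_α
  have hαp : ∀ y ∈ e.target, 0 < α y := fun y _ => W.α_pos _
  have hα0 := hαp y hy
  have hqu : 0 < q y u u := localMetric_pos he W hy u hu0
  -- The positive time component for which `(τ, u)` is null.
  let τ : ℝ := √(q y u u) / α y
  have hτ : 0 < τ := div_pos (Real.sqrt_pos.2 hqu) hα0
  have hτq : α y ^ 2 * τ ^ 2 = q y u u := by
    simp only [τ, div_pow, Real.sq_sqrt hqu.le]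
    field_simp
  have hG := isMetricOn_staticMetric hM hαs hαp
  obtain ⟨ε, hε, c, hc0, hdc0, hc⟩ :=
    exists_geodesic hG (show ((0 : ℝ), y) ∈ (univ : Set ℝ) ×ˢ e.target from ⟨mem_univ _, hy⟩) (τ, u)
  have hmem : ∀ s ∈ Ioo (-ε) ε, (c s).2 ∈ e.target := fun s hs => (hc s hs).1.2
  have h0I : (0 : ℝ) ∈ Ioo (-ε) ε := by simp [hε]
  let γ : ℝ → ℝ × X := fun s => ((productChart e).extend I4).symm (c s)
  have hγc : ∀ s ∈ Ioo (-ε) ε, (productChart e).extend I4 (γ s) = c s := fun s hs => by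
    simp only [γ]
    rw [productChart_extend, productChart_extend_symm, extend_extend_symm (hmem s hs)]
  have hγe : ∀ s ∈ Ioo (-ε) ε, (productChart e).extend I4 ∘ γ =ᶠ[𝓝 s] c := fun s hs => by
    filter_upwards [isOpen_Ioo.mem_nhds hs] with t ht using hγc t ht
  have hgeod : IsGeodesicOn I4 W.metric γ (Ioo (-ε) ε) := by
    refine ⟨fun s hs => ?_, fun s hs => ⟨productChart e, productChart_mem he, ?_, ?_, ?_⟩⟩
    · exact ((hasMFDerivAt_productChart_symm he (hmem s hs)).continuousAt.comp
        (hc s hs).2.1.continuousAt).continuousWithinAt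
    · rw [mem_productChart_source]
      exact extend_symm_mem_source (hmem s hs)
    · filter_upwards [isOpen_Ioo.mem_nhds hs] with t ht
      exact (hγe t ht).differentiableAt_iff.2 (hc t ht).2.1
    · have hg : localForm I4 W.metric (productChart e) =ᶠ[𝓝 (c s)] staticMetric q α := by
        filter_upwards [hG.isOpen.mem_nhds (hc s hs).1] with w hw
          using localForm_metric_productChart W he hw.2
      rw [hγc s hs, (hγe s hs).deriv_eq, christoffel_congr hg]
      exact (hc s hs).2.2.congr_of_eventuallyEq (hγe s hs).deriv
  have hγ0 : γ 0 = (0, (e.extend 𝓘(ℝ, E3)).symm y) := by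
    simp only [γ, hc0]
    rfl
  have hder : HasMFDerivAt 𝓘(ℝ, ℝ) I4 γ 0 ((ContinuousLinearMap.id ℝ ℝ).smulRight
      (spacetimeVector (γ 0) τ (chartDeriv e (c 0).2 u))) := by
    have h1 : HasMFDerivAt 𝓘(ℝ, ℝ) 𝓘(ℝ, ℝ × E3) c 0
        ((ContinuousLinearMap.id ℝ ℝ).smulRight (τ, u)) := by
      have := (hc 0 h0I).2.1.hasDerivAt.hasFDerivAt
      rw [hdc0] at this
      exact this.hasMFDerivAt
    have h2 := (hasMFDerivAt_productChart_symm he (hmem 0 h0I)).comp 0 h1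
    have h3 : ((ContinuousLinearMap.fst ℝ ℝ E3).prod
        (chartDeriv e (c 0).2 ∘L ContinuousLinearMap.snd ℝ ℝ E3)) ∘L
          (ContinuousLinearMap.id ℝ ℝ).smulRight (τ, u)
        = (ContinuousLinearMap.id ℝ ℝ).smulRight (τ, chartDeriv e (c 0).2 u) := by
      refine ContinuousLinearMap.ext fun s => ?_
      simp
    exact h3 ▸ h2
  have hle := hTTS ε γ τ (chartDeriv e (c 0).2 u) hε hgeod hder hτ
  have hc02 : (c 0).2 = y := by rw [hc0]
  have hd1 : (deriv c 0).1 = τ := by rw [hdc0]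
  have hd2 : (deriv c 0).2 = u := by rw [hdc0]
  have key := hess_le_of_geodesic (f := localFun S.f e) hM hαs hαp
    (contDiffOn_localFun he S.smooth_f) hε hc
  rw [hc02, hd1, hd2] at key
  refine key h0 hu hτq (hle ?_ ?_ ?_)
  · have h := localForm_productChart_apply he W.metric (z := c 0) (hmem 0 h0I) (τ, u) (τ, u)
    rw [localForm_metric_productChart W he (hmem 0 h0I), staticMetric_apply] at h
    refine h.symm.trans ?_
    rw [hc02]
    change q y u u - α y ^ 2 * (τ * τ) = 0
    rw [← hτq]
    ring
  · rw [hγ0]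
    exact h0
  · have h := fderiv_localFun he S.smooth_f (hmem 0 h0I) u
    rw [hc02, hu] at h
    rw [hc02]
    have h' := h.symm
    rw [← hc02] at h' ⊢
    exact h'

end Chart

/-! ### The foliation by `f / (α |D f|)`. -/

/-- The squared norm of the gradient of a function on the slice. -/
def slopeSq (W : StaticSpacetime X) (h : X → ℝ) (p : X) : ℝ :=
  let q : E3 →L[ℝ] E3 →L[ℝ] ℝ := W.q.inner p
  let dh : E3 →L[ℝ] ℝ := mfderiv 𝓘(ℝ, E3) 𝓘(ℝ, ℝ) h p
  dh (q.inverse dh)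

/-- The derivative of the inverse chart is an isometry from the coordinate metric to `q`, so it
carries the coordinate gradient to the intrinsic one. Hence the chart-free factor has the expected
expression in every chart. -/
lemma gradSq_localFun (he : e ∈ IsManifold.maximalAtlas 𝓘(ℝ, E3) ∞ X) (hy : y ∈ e.target)
    {h : X → ℝ} (hh : ContMDiff 𝓘(ℝ, E3) 𝓘(ℝ, ℝ) ∞ h) :
    gradSq (W.localMetric e) (localFun h e) y = slopeSq W h ((e.extend 𝓘(ℝ, E3)).symm y) := by
  set p := (e.extend 𝓘(ℝ, E3)).symm y with hp
  let Q : E3 →L[ℝ] E3 →L[ℝ] ℝ := W.q.inner p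
  let dh : E3 →L[ℝ] ℝ := mfderiv 𝓘(ℝ, E3) 𝓘(ℝ, ℝ) h p
  have hQ : Q.IsInvertible := isInvertible_of_pos Q (W.q.pos p)
  have hM := isMetricOn_localMetric he W
  obtain ⟨G, hG⟩ := (bijective_chartDeriv he hy).2 (Q.inverse dh)
  have hd : ∀ v, fderiv ℝ (localFun h e) y v = dh (chartDeriv e y v) := fderiv_localFun he hh hy
  have hgrad : grad (W.localMetric e) (localFun h e) y = G := by
    apply (hM.inv y hy).injective
    rw [metric_grad hM hy]
    ext v
    rw [hd]
    change _ = Q (chartDeriv e y G) (chartDeriv e y v)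
    rw [hG, hQ.self_apply_inverse]
  rw [gradSq_eq_fderiv hM hy, hgrad, hd, hG]
  rfl

/-- The positive factor `1 / (α |D f|)`. -/
def scaleFactor (W : StaticSpacetime X) (S : DividingSurface X) (p : X) : ℝ :=
  (W.α p * √(slopeSq W S.f p))⁻¹

/-- The function `f / (α |D f|)`, whose foliation has lapse `α` on the surface. -/
def lapseFunction (W : StaticSpacetime X) (S : DividingSurface X) (p : X) : ℝ :=
  S.f p * scaleFactor W S p

/-- The coordinate domain in which both `f` and `f / (α |D f|)` have no critical points. -/
def regularDomain (W : StaticSpacetime X) (S : DividingSurface X)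
    (e : OpenPartialHomeomorph X E3) : Set E3 :=
  (e.target ∩ {y | fderiv ℝ (localFun S.f e) y ≠ 0})
    ∩ {y | fderiv ℝ (localFun (lapseFunction W S) e) y ≠ 0}

section Regular

variable (he : e ∈ IsManifold.maximalAtlas 𝓘(ℝ, E3) ∞ X)

include he

lemma isFoliationOn_f : IsFoliationOn (W.localMetric e) (localFun S.f e)
    (e.target ∩ {y | fderiv ℝ (localFun S.f e) y ≠ 0}) :=
  isFoliationOn_localFun he W e.open_target subset_rfl (contDiffOn_localFun he S.smooth_f)

lemma localFun_scaleFactor (hy : y ∈ e.target) :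
    localFun (scaleFactor W S) e y
      = (localFun W.α e y * √(gradSq (W.localMetric e) (localFun S.f e) y))⁻¹ := by
  rw [gradSq_localFun he hy S.smooth_f]
  rfl

lemma contDiffOn_scaleFactor : ContDiffOn ℝ ∞ (localFun (scaleFactor W S) e)
    (e.target ∩ {y | fderiv ℝ (localFun S.f e) y ≠ 0}) := by
  have H := isFoliationOn_f (W := W) (S := S) he
  have h1 : ContDiffOn ℝ ∞
      (fun y => (localFun W.α e y * √(gradSq (W.localMetric e) (localFun S.f e) y))⁻¹)
      (e.target ∩ {y | fderiv ℝ (localFun S.f e) y ≠ 0}) :=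
    (((contDiffOn_localFun he W.smooth_α).mono inter_subset_left).mul
      (H.contDiffOn_gradSq.sqrt fun y hy => (H.gradSq_pos hy).ne')).inv
      fun y hy => (mul_pos (W.α_pos _) (H.sqrt_gradSq_pos hy)).ne'
  exact h1.congr fun y hy => localFun_scaleFactor he hy.1

lemma contDiffOn_lapseFunction : ContDiffOn ℝ ∞ (localFun (lapseFunction W S) e)
    (e.target ∩ {y | fderiv ℝ (localFun S.f e) y ≠ 0}) :=
  ((contDiffOn_localFun he S.smooth_f).mono inter_subset_left).mul (contDiffOn_scaleFactor he)

lemma isFoliationOn_lapseFunction :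
    IsFoliationOn (W.localMetric e) (localFun (lapseFunction W S) e) (regularDomain W S e) :=
  isFoliationOn_localFun he W (isFoliationOn_f (W := W) he).metric.isOpen inter_subset_left
    (contDiffOn_lapseFunction he)

lemma fderiv_localFun_f_ne_zero (hy : y ∈ e.target)
    (h : mfderiv 𝓘(ℝ, E3) 𝓘(ℝ, ℝ) S.f ((e.extend 𝓘(ℝ, E3)).symm y) ≠ 0) :
    fderiv ℝ (localFun S.f e) y ≠ 0 := by
  refine fun h0 => h ?_
  refine ContinuousLinearMap.ext fun v => ?_
  obtain ⟨v', rfl⟩ := (bijective_chartDeriv he hy).2 v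
  have := fderiv_localFun he S.smooth_f hy v'
  rw [h0] at this
  exact this.symm

/-- Where `f = 0` the differential of `f ρ` is `ρ df`, and `ρ > 0`, so regularity of `f` passes to
the new function. -/
lemma mem_regularDomain (hy : y ∈ e.target) (h0 : localFun S.f e y = 0) :
    y ∈ regularDomain W S e := by
  have h1 : y ∈ e.target ∩ {y | fderiv ℝ (localFun S.f e) y ≠ 0} :=
    ⟨hy, fderiv_localFun_f_ne_zero he hy (S.regular _ h0)⟩
  have H := isFoliationOn_f (W := W) (S := S) he
  refine ⟨h1, ?_⟩
  have h2 : fderiv ℝ (localFun (lapseFunction W S) e) y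
      = localFun (scaleFactor W S) e y • fderiv ℝ (localFun S.f e) y :=
    fderiv_mul_of_eq_zero H.metric h1 H.smooth (contDiffOn_scaleFactor he) h0
  have h3 : localFun (scaleFactor W S) e y ≠ 0 := by
    rw [localFun_scaleFactor he hy]
    exact inv_ne_zero (mul_pos (W.α_pos _) (H.sqrt_gradSq_pos h1)).ne'
  rw [mem_ofPred_eq, h2]
  exact smul_ne_zero h3 h1.2

lemma contMDiffAt_lapseFunction {p : X} (hp : p ∈ e.source)
    (hy : e.extend 𝓘(ℝ, E3) p ∈ regularDomain W S e) :
    ContMDiffAt 𝓘(ℝ, E3) 𝓘(ℝ, ℝ) ∞ (lapseFunction W S) p :=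
  contMDiffAt_of_contDiffAt he hp ((contDiffOn_lapseFunction he).contDiffAt
    ((isFoliationOn_f (W := W) he).metric.isOpen.mem_nhds hy.1))

end Regular

/-- The points near the surface, in the domains of the charts. -/
def regularSet (W : StaticSpacetime X) (S : DividingSurface X) : Set X :=
  ⋃ e ∈ IsManifold.maximalAtlas 𝓘(ℝ, E3) ∞ X,
    e.source ∩ e.extend 𝓘(ℝ, E3) ⁻¹' regularDomain W S e

lemma isOpen_regularSet (W : StaticSpacetime X) (S : DividingSurface X) :
    IsOpen (regularSet W S) := by
  refine isOpen_biUnion fun e he => ?_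
  exact (e.contMDiffOn_extend he).continuousOn.isOpen_inter_preimage e.open_source
    (isFoliationOn_lapseFunction he).metric.isOpen

lemma extend_mem_target {p : X} (hp : p ∈ e.source) : e.extend 𝓘(ℝ, E3) p ∈ e.target := by
  simpa using e.map_source hp

lemma extend_symm_extend {p : X} (hp : p ∈ e.source) :
    (e.extend 𝓘(ℝ, E3)).symm (e.extend 𝓘(ℝ, E3) p) = p := by
  simp [hp]

/-- `f / (α |D f|)` defines a radial foliation. -/
theorem isRadialFoliation_lapseFunction (W : StaticSpacetime X) (S : DividingSurface X) :
    IsRadialFoliation S (lapseFunction W S) := by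
  refine ⟨regularSet W S, isOpen_regularSet W S, fun p hp => ?_, fun p hp => ?_, fun p hp => ?_⟩
  · have he := IsManifold.chart_mem_maximalAtlas (I := 𝓘(ℝ, E3)) (n := ∞) p
    have hps := mem_chart_source E3 p
    refine mem_biUnion he ⟨hps, mem_regularDomain he (extend_mem_target hps) ?_⟩
    simp only [localFun, Function.comp_apply, extend_symm_extend hps]
    exact hp
  · obtain ⟨e, he, hps, hy⟩ := mem_iUnion₂.1 hp
    exact (contMDiffAt_lapseFunction he hps hy).contMDiffWithinAt
  · obtain ⟨e, he, hps, hy⟩ := mem_iUnion₂.1 hp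
    have hyt := extend_mem_target (e := e) hps
    have H := isFoliationOn_f (W := W) (S := S) he
    -- Positivity of the factor gives `f ρ` the same zero set and the same positive side as `f`.
    have hpos : 0 < scaleFactor W S p := by
      have h1 := localFun_scaleFactor (W := W) (S := S) he hyt
      simp only [localFun, Function.comp_apply, extend_symm_extend hps] at h1
      rw [h1]
      exact inv_pos.2 (mul_pos (W.α_pos _) (H.sqrt_gradSq_pos hy.1))
    refine ⟨fun h => hy.2 ?_, ?_, ?_⟩
    · have hd := (contMDiffAt_lapseFunction he hps hy).mdifferentiableAt (by simp)
      rw [← extend_symm_extend hps] at hd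
      ext1 v
      have h2 := fderiv_comp_extend_symm he hyt hd v
      refine h2.trans ?_
      rw [extend_symm_extend hps, h]
      rfl
    · simp [lapseFunction, hpos.ne']
    · simp [lapseFunction, hpos]

/-- The signs of the mean curvature and of its normal derivative on the surface. -/
theorem curvature_conditions_lapseFunction {G : ℝ}
    {T : ∀ x : ℝ × X, TangentSpace I4 x →L[ℝ] TangentSpace I4 x →L[ℝ] ℝ}
    (hT : EinsteinEquations I4 G W.metric T)
    (hTTS : IsTTS W S) (hconvex : IsConvexSurface W S)
    (hρP : EnergyPlusRadialPressureVanishes W S T)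
    (he : e ∈ IsManifold.maximalAtlas 𝓘(ℝ, E3) ∞ X) {p : X} (hp : p ∈ e.source)
    (hpS : p ∈ S.carrier) :
    0 ≤ meanCurvature (W.localMetric e) (localFun (lapseFunction W S) e)
        (e.extend 𝓘(ℝ, E3) p) ∧
      0 ≤ normalDerivMeanCurvature (W.localMetric e) (localFun (lapseFunction W S) e)
        (e.extend 𝓘(ℝ, E3) p) ∧
      ((∃ u v, extrinsicCurvature (W.localMetric e) (localFun S.f e)
          (e.extend 𝓘(ℝ, E3) p) u v ≠ 0) →
        0 < meanCurvature (W.localMetric e) (localFun (lapseFunction W S) e)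
          (e.extend 𝓘(ℝ, E3) p)) := by
  have hyt := extend_mem_target hp
  have h0 : localFun S.f e (e.extend 𝓘(ℝ, E3) p) = 0 := by
    simp only [localFun, Function.comp_apply, extend_symm_extend hp]
    exact hpS
  have hy := mem_regularDomain (W := W) he hyt h0
  have Hr := isFoliationOn_lapseFunction (W := W) (S := S) he
  have H1 := isFoliationOn_f (W := W) (S := S) he
  have hsub : regularDomain W S e ⊆ e.target := fun z hz => hz.1.1
  have H : IsFoliationOn (W.localMetric e) (localFun S.f e) (regularDomain W S e) :=
    ⟨Hr.metric, Hr.pos, H1.smooth.mono inter_subset_left, fun z hz => hz.1.2⟩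
  exact curvature_conditions (f := localFun S.f e) (ρ := localFun (scaleFactor W S) e)
    (α := localFun W.α e) H Hr hy h0
    ((contDiffOn_localFun he W.smooth_α).mono hsub) (fun z _ => W.α_pos _)
    ((contDiffOn_scaleFactor he).mono inter_subset_left)
    (fun z hz => localFun_scaleFactor he (hsub hz))
    (ricci_unitNormal he hT hρP H hsub hy h0)
    (fun κ hκ => hconvex e he p hp hpS κ hκ)
    (fun u hu => hess_le_of_isTTS he hTTS hyt h0 u hu)

end Assembly

end

theorem proposition2 {X : Type*} [TopologicalSpace X] [ChartedSpace E3 X]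
    [IsManifold 𝓘(ℝ, E3) ∞ X] (W : StaticSpacetime X) (S : DividingSurface X)
    (G : ℝ) (hG : 0 < G)
    (T : ∀ x : ℝ × X, TangentSpace I4 x →L[ℝ] TangentSpace I4 x →L[ℝ] ℝ)
    (hT : EinsteinEquations I4 G W.metric T)
    (hTTS : IsTTS W S) (hconvex : IsConvexSurface W S)
    (hρP : EnergyPlusRadialPressureVanishes W S T) :
    IsWeakLTS W S ∧ (ExtrinsicCurvatureNowhereZero W S → IsLTS W S) := by
  refine ⟨⟨lapseFunction W S, isRadialFoliation_lapseFunction W S, fun e he p hp hpS => ?_⟩,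
    fun hk => ⟨lapseFunction W S, isRadialFoliation_lapseFunction W S, fun e he p hp hpS => ?_⟩⟩
  · obtain ⟨h1, h2, -⟩ := curvature_conditions_lapseFunction hT hTTS hconvex hρP he hp hpS
    exact ⟨h1, h2⟩
  · obtain ⟨-, h2, h3⟩ := curvature_conditions_lapseFunction hT hTTS hconvex hρP he hp hpS
    exact ⟨h3 (hk e he p hp hpS), h2⟩
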